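/- **Setting (rare event Perron–Frobenius operators, REPFO).** Let $M$ be a metric space, $T:M\to M$ measurable, $(V,\|\cdot\|)$ a complex Banach space of functions or distributions on $M$ that contains the constant functions, $\nu_0$ a finite reference measure on $M$ such that $f\mapsto\nu_0(f)=\int f\,d\nu_0$ is a bounded functional on $V$, $E$ a topological space with a distinguished point $0$, and $(A_\varepsilon)_{\varepsilon\in E}$ measurable subsets of $M$ with $1_{A_\varepsilon}f\in V$ for $f\in V$. Elements of $V$ act on a space of bounded measurable test functions which contains $1$ and is stable under $h\mapsto h\circ T$ and $h\mapsto 1_{A_\varepsilon}h$ (a function $f$ acts by $h\mapsto\int fh\,d\nu_0$), and $\nu_0(f)$ is the value of $f$ at $1$. Let $P_0:V\to V$ be the Perron–Frobenius operator of $T$ (dual to $h\mapsto h\circ T$), and $P_\varepsilon f=P_0(1_{M\setminus A_\varepsilon}f)$, where for $\varepsilon=0$ this is $P_0$ (no effective hole). Let $\varphi_0\in V$ with $P_0\varphi_0=\varphi_0$ be such that $\mu_0=\varphi_0\nu_0$ is a probability measure, and assume that * $Q_0:=P_0-\varphi_0\otimes\nu_0$ has spectral radius $<1$; * there are a seminorm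 $|\cdot|_w\le\|\cdot\|$ on $V$ and constants $\alpha\in(0,1)$, $D>0$ such that, for all $\varepsilon\in E$, $f\in V$, $n\in\mathbb N$: the residual spectrum of $P_\varepsilon$ lies in $\{|z|\le\alpha\}$, $|P_\varepsilon^nf|_w\le D|f|_w$, and $\|P_\varepsilon^nf\|\le D\alpha^n\|f\|+D|f|_w$; * $|P_\varepsilon f-P_0f|_w\le\pi_\varepsilon\|f\|$ for all $f\in V$, $\varepsilon\in E$, with $\pi_\varepsilon\to0$ as $\varepsilon\to0$; * there is a constant $K$ with $|\nu_0(1_{A_\varepsilon}f)|\cdot\|1_{A_\varepsilon}\varphi_0\|\le K\|f\|\cdot|\nu_0(1_{A_\varepsilon}\varphi_0)|$ for all $f\in V$, $\varepsilon\in E$. **Notation.** $\tau_\varepsilon(x)=\inf\{i\ge0:T^ix\in A_\varepsilon\}$, $\eta_\varepsilon=\|\nu_0(P_0-P_\varepsilon)\|$, $\Delta_\varepsilon=\nu_0((P_0-P_\varepsilon)\varphi_0)=\mu_0(A_\varepsilon)$ and $$q_{k,\varepsilon}=\frac{\nu_0\big((P_0-P_\varepsilon)P_\varepsilon^k(P_0-P_\varepsilon)\varphi_0\big)}{\Delta_\varepsilon}.$$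 For a neighbourhood $U$ of $0$ in $E$, a *leading decomposition on $U$* consists of $\lambda_\varepsilon\in\mathbb C\setminus\{0\}$, $\varphi_\varepsilon\in V$, bounded functionals $\nu_\varepsilon$ and bounded operators $Q_\varepsilon$ on $V$ ($\varepsilon\in U$), with $\lambda_0=1$ and with $\varphi_0,\nu_0$ as above at $\varepsilon=0$, such that $$\lambda_\varepsilon^{-1}P_\varepsilon=\varphi_\varepsilon\otimes\nu_\varepsilon+Q_\varepsilon,\quad P_\varepsilon\varphi_\varepsilon=\lambda_\varepsilon\varphi_\varepsilon,\quad \nu_\varepsilon P_\varepsilon=\lambda_\varepsilon\nu_\varepsilon,\quad Q_\varepsilon\varphi_\varepsilon=0,\quad \nu_\varepsilon Q_\varepsilon=0,$$ $\sum_{n\ge0}\sup_{\varepsilon\in U}\|Q_\varepsilon^n\|<\infty$, $\nu_0(\varphi_\varepsilon)=1$ and $\sup_{\varepsilon\in U}\|\varphi_\varepsilon\|<\infty$. For it, put $\kappa_N=\sum_{k\ge N}\sup_{\varepsilon\in U}\|Q_\varepsilon^k\|$ and $\delta_\varepsilon=\min_{N\ge1}(N\eta_\varepsilon+\kappa_N)$.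 **Proposition.** In this setting, suppose that $\mu_0(A_\varepsilon)>0$ for all $\varepsilon\ne0$, that the limits $q_k=\lim_{\varepsilon\to0}q_{k,\varepsilon}$ exist for all $k\ge0$, and that $\theta:=1-\sum_{k=0}^\infty q_k>0$ (all limits $\varepsilon\to0$ are along $\varepsilon\neq0$). Then a leading decomposition exists on some neighbourhood of $0$; and for every neighbourhood $U$ of $0$ and every leading decomposition on $U$, the minimum $\delta_\varepsilon$ is attained for each $\varepsilon\ne0$, $\delta_\varepsilon=\mathcal O(\eta_\varepsilon\log\eta_\varepsilon)$ as $\varepsilon\to0$, and there are a constant $C>0$ and numbers $\xi_\varepsilon$ with $\lim_{\varepsilon\to0}\xi_\varepsilon=\theta$ such that, for all $\varepsilon\neq0$ sufficiently close to $0$, $\xi_\varepsilon>0$ and, for all $t>0$, $$\left|\mu_0\Big\{\tau_\varepsilon\ge\frac{t}{\xi_\varepsilon\,\mu_0(A_\varepsilon)}\Big\}-e^{-t}\right|\le C\,\delta_\varepsilon\,(t\vee1)\,e^{-t}.$$ -/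

import Mathlib

open Filter Topology MeasureTheory

/-- The residual spectrum: `z - P` is injective but its range is not dense. -/
def residualSpectrum {V : Type*} [NormedAddCommGroup V] [NormedSpace ℂ V]
    (P : V →L[ℂ] V) : Set ℂ :=
  {z | Function.Injective (fun f : V => z • f - P f) ∧
    ¬ DenseRange (fun f : V => z • f - P f)}

/-- A family of rare event Perron-Frobenius operators, with parameter space `E` and
distinguished parameter `0 : E`.

The elements of the Banach space `V` are functions or distributions on `M`: each of them acts
linearly, through `dist`, on a space `test` of bounded measurable test functions. A function `f`
acts by `h ↦ ∫ f h dν₀`. (`dist` need not be injective, since functions in `V` may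
be distinguished although they agree almost everywhere, as in spaces of functions of bounded
variation.) On distributions, the transfer operator of `T` is dual to `h ↦ h ∘ T`,
multiplication by an indicator function is dual to the same multiplication of test functions,
and the integral `ν₀(f)` is the value of `f` at the test function `1`. -/
structure REPFO (M V E : Type*) [MetricSpace M] [MeasurableSpace M] [BorelSpace M]
    [NormedAddCommGroup V] [NormedSpace ℂ V] [TopologicalSpace E] [Zero E] where
  /-- the dynamical system -/
  T : M → M
  measurable_T : Measurable T
  /-- the holes `A_ε` -/
  A : E → Set M
  measurableSet_A : ∀ ε, MeasurableSet (A ε)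
  /-- the test functions -/
  test : Submodule ℂ (M → ℂ)
  test_measurable : ∀ h ∈ test, Measurable h
  test_bounded : ∀ h ∈ test, ∃ c : ℝ, ∀ x, ‖h x‖ ≤ c
  test_one : (fun _ => (1 : ℂ)) ∈ test
  test_comp : ∀ h ∈ test, h ∘ T ∈ test
  test_indicator : ∀ ε, ∀ h ∈ test, (A ε).indicator h ∈ test
  /-- the elements of `V` as functionals on the test functions -/
  dist : V →ₗ[ℂ] (test →ₗ[ℂ] ℂ)
  /-- the reference measure -/
  refMeasure : Measure M
  finite_refMeasure : IsFiniteMeasure refMeasure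
  /-- the constant function `1` as an element of `V` -/
  one : V
  dist_one : ∀ h : test, dist one h = ∫ x, (h : M → ℂ) x ∂refMeasure
  /-- the functional `f ↦ ν₀(f)`, which is bounded on `V` -/
  ν₀ : V →L[ℂ] ℂ
  ν₀_eq : ∀ f, ν₀ f = dist f ⟨fun _ => 1, test_one⟩
  /-- the operators `P_ε`; the Perron-Frobenius operator of `T` is `P 0` -/
  P : E → V →L[ℂ] V
  dist_P : ∀ f (h : test), dist (P 0 f) h = dist f ⟨(h : M → ℂ) ∘ T, test_comp h h.2⟩
  /-- the multiplication `f ↦ 1_{A_ε} f`, which maps `V` into `V` -/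
  mulA : E → V →ₗ[ℂ] V
  dist_mulA : ∀ ε f (h : test),
    dist (mulA ε f) h = dist f ⟨(A ε).indicator (h : M → ℂ), test_indicator ε h h.2⟩
  /-- `P_ε f = P₀ (1_{M \ A_ε} f)`; for `ε = 0` this says that there is no effective hole. -/
  P_eq : ∀ ε f, P ε f = P 0 (f - mulA ε f)
  /-- the invariant density -/
  φ₀ : V
  /-- the invariant probability measure `μ₀ = φ₀ ν₀` -/
  μ₀ : Measure M
  probability_μ₀ : IsProbabilityMeasure μ₀
  dist_φ₀ : ∀ h : test, dist φ₀ h = ∫ x, (h : M → ℂ) x ∂μ₀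
  P_φ₀ : P 0 φ₀ = φ₀
  /-- mixing: `P₀ = φ₀ ⊗ ν₀ + Q₀`, where `Q₀` has spectral radius less than one -/
  mixing : spectralRadius ℂ (P 0 - ν₀.smulRight φ₀) < 1
  /-- the weak norm, which may be a seminorm -/
  weak : Seminorm ℂ V
  weak_le : ∀ f, weak f ≤ ‖f‖
  α : ℝ
  α_pos : 0 < α
  α_lt_one : α < 1
  D : ℝ
  D_pos : 0 < D
  residual : ∀ ε, residualSpectrum (P ε) ⊆ {z | ‖z‖ ≤ α}
  weak_bound : ∀ ε f (n : ℕ), weak ((P ε ^ n) f) ≤ D * weak f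
  lasota_yorke : ∀ ε f (n : ℕ), ‖(P ε ^ n) f‖ ≤ D * α ^ n * ‖f‖ + D * weak f
  /-- the size `π_ε` of the perturbation -/
  size : E → ℝ
  size_tendsto : Tendsto size (𝓝[≠] 0) (𝓝 0)
  size_bound : ∀ ε f, weak (P ε f - P 0 f) ≤ size ε * ‖f‖
  regular : ∃ K : ℝ, ∀ ε f,
    ‖ν₀ (mulA ε f)‖ * ‖mulA ε φ₀‖ ≤ K * ‖f‖ * ‖ν₀ (mulA ε φ₀)‖

namespace REPFO

variable {M V E : Type*} [MetricSpace M] [MeasurableSpace M] [BorelSpace M]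
  [NormedAddCommGroup V] [NormedSpace ℂ V] [TopologicalSpace E] [Zero E]

/-- First hitting time of `A_ε`, `τ_ε(x) = inf {i ≥ 0 : Tⁱ x ∈ A_ε}`, with `inf ∅ = ∞`. -/
noncomputable def τ (S : REPFO M V E) (ε : E) (x : M) : EReal :=
  ⨅ (i : ℕ) (_ : S.T^[i] x ∈ S.A ε), ((i : ℝ) : EReal)

/-- `η_ε = ‖ν₀ (P₀ - P_ε)‖`. -/
noncomputable def η (S : REPFO M V E) (ε : E) : ℝ :=
  ‖S.ν₀.comp (S.P 0 - S.P ε)‖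

/-- `Δ_ε = ν₀ ((P₀ - P_ε) φ₀)`, which equals `μ₀(A_ε)`. -/
noncomputable def Δ (S : REPFO M V E) (ε : E) : ℂ :=
  S.ν₀ ((S.P 0 - S.P ε) S.φ₀)

/-- `q_{k,ε} = ν₀ ((P₀ - P_ε) P_ε^k (P₀ - P_ε) φ₀) / Δ_ε`. -/
noncomputable def q (S : REPFO M V E) (k : ℕ) (ε : E) : ℂ :=
  S.ν₀ ((S.P 0 - S.P ε) ((S.P ε ^ k) ((S.P 0 - S.P ε) S.φ₀))) / S.Δ ε

/-- Decompositions `λ_ε⁻¹ P_ε = φ_ε ⊗ ν_ε + Q_ε` for all parameters `ε` in `U`, with summable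
`sup_{ε ∈ U} ‖Q_εⁿ‖` and with `φ_ε` bounded and normalised by `ν₀(φ_ε) = 1`. -/
structure Decomposition (S : REPFO M V E) (U : Set E) where
  eigenvalue : E → ℂ
  φ : E → V
  ν : E → V →L[ℂ] ℂ
  Q : E → V →L[ℂ] V
  eigenvalue_zero : eigenvalue 0 = 1
  φ_zero : φ 0 = S.φ₀
  ν_zero : ν 0 = S.ν₀
  eigenvalue_ne : ∀ ε ∈ U, eigenvalue ε ≠ 0
  decomp : ∀ ε ∈ U, (eigenvalue ε)⁻¹ • S.P ε = (ν ε).smulRight (φ ε) + Q ε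
  P_φ : ∀ ε ∈ U, S.P ε (φ ε) = eigenvalue ε • φ ε
  ν_P : ∀ ε ∈ U, (ν ε).comp (S.P ε) = eigenvalue ε • ν ε
  Q_φ : ∀ ε ∈ U, Q ε (φ ε) = 0
  ν_Q : ∀ ε ∈ U, (ν ε).comp (Q ε) = 0
  summable : ∑' n : ℕ, ⨆ ε ∈ U, ‖Q ε ^ n‖ₑ < ⊤
  normalised : ∀ ε ∈ U, S.ν₀ (φ ε) = 1
  bounded : ∃ c > (0 : ℝ), ∀ ε ∈ U, ‖φ ε‖ ≤ c

/-- `κ_N = ∑_{k ≥ N} sup_{ε ∈ U} ‖Q_ε^k‖`, a finite number by `summable`. -/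
noncomputable def Decomposition.κ {S : REPFO M V E} {U : Set E} (L : S.Decomposition U)
    (N : ℕ) : ℝ :=
  (∑' k : ℕ, ⨆ ε ∈ U, ‖L.Q ε ^ (N + k)‖ₑ).toReal

/-- The numbers `N η_ε + κ_N` with `N ≥ 1`. -/
def Decomposition.errors {S : REPFO M V E} {U : Set E} (L : S.Decomposition U)
    (ε : E) : Set ℝ :=
  {r | ∃ N : ℕ, 1 ≤ N ∧ r = N * S.η ε + L.κ N}

/-- `δ_ε = min_{N ≥ 1} (N η_ε + κ_N)`. -/
noncomputable def Decomposition.δ {S : REPFO M V E} {U : Set E} (L : S.Decomposition U)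
    (ε : E) : ℝ :=
  sInf (L.errors ε)

end REPFO

/-! By duality, `ν₀(P_ε^n φ₀)` is the probability of avoiding the hole before time `n`, so
everything rests on comparing it with `λ_ε^n`, with relative error `O(δ_ε)` uniformly in `n`
(`exists_norm_ν₀_P_pow_φ₀_sub_le`). Let `N` attain the minimum defining `δ_ε`. Up to time `N` both
numbers are within `O(N η_ε)` of 1. From time `N` on, `P_ε^n = λ_ε^n (φ_ε ⊗ ν_ε + Q_ε^n)` with
`‖Q_ε^n‖ ≤ κ_N`, and the comparison at `N` itself shows `ν_ε(φ₀) = 1 + O(δ_ε)`.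

With `ξ_ε = -log|λ_ε| / μ₀(A_ε)` the powers `|λ_ε|^n` are exact exponentials; rounding `t/p`, where
`p = -log|λ_ε|`, up to an integer costs a factor `1 + O(p)`, and `p = O(η_ε)`. The limit `ξ_ε → θ`
is the first order expansion of the eigenvalue (`tendsto_one_sub_eigenvalue_div`): the mass falling
into the hole at step `n` is computed by telescoping, which gives the `q_{k,ε}`, and by the spectral
decomposition. The remainder is `o(μ₀(A_ε))` by the regularity assumption.

Decompositions exist because some fixed power of `P_ε` is close in operator norm to a rank one
operator, although `P_ε` is close to `P₀` only in the weak sense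
(`eventually_norm_P_pow_sub_rankOne_le`). Such operators have an isolated leading eigenvalue, found
by a scalar fixed point equation (`exists_leading_eigenvalue`), and the spectral data of the power
belong to `P_ε` itself (`exists_decomposition_of_pow`). -/

/-! ### Elementary estimates. -/

/-- The constants depend on `N` and `M` only, not on the sequence; this makes the decay of `‖Q_ε^n‖`
uniform in `ε`. -/
theorem exists_geometric_bound_of_submultiplicative {N : ℕ} (hN : 0 < N) (M : ℝ) :
    ∃ C > (0 : ℝ), ∃ ρ : ℝ, 0 < ρ ∧ ρ < 1 ∧ ∀ a : ℕ → ℝ, (∀ n, 0 ≤ a n) →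
      (∀ m n, a (m + n) ≤ a m * a n) → (∀ k < N, a k ≤ M) → a N ≤ 1 / 2 →
      ∀ n, a n ≤ C * ρ ^ n := by
  obtain ⟨ρ, hρ0, hρ⟩ : ∃ ρ : ℝ, 0 < ρ ∧ ρ ^ N = 1 / 2 :=
    ⟨(1 / 2 : ℝ) ^ ((N : ℝ)⁻¹), by positivity, Real.rpow_inv_natCast_pow (by norm_num) hN.ne'⟩
  have hρ1 : ρ < 1 := by
    by_contra! h
    linarith [one_le_pow₀ h (n := N)]
  have hC : 0 < 2 * max M 1 := by positivity
  refine ⟨2 * max M 1, hC, ρ, hρ0, hρ1, fun a ha hmul hM hhalf n => ?_⟩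
  induction n using Nat.strong_induction_on with
  | _ n ih =>
    rcases lt_or_ge n N with h | h
    · have h1 : ρ ^ N ≤ ρ ^ n := pow_le_pow_of_le_one hρ0.le hρ1.le h.le
      calc a n ≤ max M 1 := (hM n h).trans (le_max_left _ _)
        _ = 2 * max M 1 * ρ ^ N := by rw [hρ]; ring
        _ ≤ _ := by gcongr
    · obtain ⟨j, rfl⟩ := Nat.exists_eq_add_of_le h
      have h1 := ih j (by omega)
      calc a (N + j) ≤ a N * a j := hmul _ _
        _ ≤ 1 / 2 * (2 * max M 1 * ρ ^ j) := mul_le_mul hhalf h1 (ha _) (by norm_num)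
        _ = _ := by rw [pow_add, hρ]; ring

theorem exists_geometric_bound_of_tendsto_zero {a : ℕ → ℝ} (h0 : ∀ n, 0 ≤ a n)
    (hmul : ∀ m n, a (m + n) ≤ a m * a n) (ha : Tendsto a atTop (𝓝 0)) :
    ∃ C > (0 : ℝ), ∃ ρ : ℝ, 0 < ρ ∧ ρ < 1 ∧ ∀ n, a n ≤ C * ρ ^ n := by
  obtain ⟨N, hN, hN1⟩ := ((ha.eventually (ge_mem_nhds (by norm_num : (0 : ℝ) < 1 / 2))).and
    (eventually_gt_atTop 0)).exists
  obtain ⟨M, hM⟩ := ha.bddAbove_range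
  obtain ⟨C, hC, ρ, hρ0, hρ1, h⟩ := exists_geometric_bound_of_submultiplicative hN1 M
  exact ⟨C, hC, ρ, hρ0, hρ1, h a h0 hmul (fun k _ => hM ⟨k, rfl⟩) hN⟩

theorem norm_pow_add_le {R : Type*} [SeminormedRing R] (a : R) (m n : ℕ) :
    ‖a ^ (m + n)‖ ≤ ‖a ^ m‖ * ‖a ^ n‖ := by
  rw [pow_add]; exact norm_mul_le _ _

theorem tendsto_pow_zero_of_spectralRadius_lt_one {A : Type*} [NormedRing A]
    [NormedAlgebra ℂ A] [CompleteSpace A] {a : A} (ha : spectralRadius ℂ a < 1) :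
    Tendsto (fun n => ‖a ^ n‖) atTop (𝓝 0) := by
  obtain ⟨r, hr, hr1⟩ := ENNReal.lt_iff_exists_nnreal_btwn.1 ha
  have hlim := spectrum.pow_nnnorm_pow_one_div_tendsto_nhds_spectralRadius a
  have hr1' : r < 1 := by exact_mod_cast hr1
  have hev : ∀ᶠ n : ℕ in atTop, ‖a ^ n‖ ≤ (r : ℝ) ^ n := by
    filter_upwards [hlim.eventually_lt_const hr, eventually_gt_atTop 0] with n hn hn0
    have hn1 : (0 : ℝ) < n := by exact_mod_cast hn0
    have h1 := ENNReal.rpow_lt_rpow hn hn1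
    rw [← ENNReal.rpow_mul, one_div, inv_mul_cancel₀ hn1.ne', ENNReal.rpow_one,
      ENNReal.rpow_natCast] at h1
    have h2 : ‖a ^ n‖₊ < r ^ n := by exact_mod_cast h1
    exact_mod_cast h2.le
  exact squeeze_zero' (Eventually.of_forall fun n => norm_nonneg _) hev
    (tendsto_pow_atTop_nhds_zero_of_lt_one r.2 hr1')

theorem norm_pow_sub_one_le_of_norm_sub_one_le {z : ℂ} {x : ℝ} (hz : ‖z - 1‖ ≤ x) {n : ℕ} (hn : n * x ≤ 1) :
    ‖z ^ n - 1‖ ≤ 2 * (n * x) := by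
  have hx : 0 ≤ x := (norm_nonneg _).trans hz
  have h1 : ‖z ^ n - 1‖ ≤ (1 + x) ^ n - 1 := by
    clear hn
    induction n with
    | zero => simp
    | succ n ih =>
      have hz1 : ‖z‖ ≤ 1 + x := by
        calc ‖z‖ = ‖1 + (z - 1)‖ := by congr 1; ring
          _ ≤ 1 + x := norm_add_le_of_le norm_one.le hz
      calc ‖z ^ (n + 1) - 1‖ = ‖z * (z ^ n - 1) + (z - 1)‖ := by congr 1; ring
        _ ≤ (1 + x) * ((1 + x) ^ n - 1) + x := by
          refine norm_add_le_of_le ?_ hz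
          rw [norm_mul]; gcongr
        _ = _ := by ring
  have h2 : (1 + x) ^ n ≤ Real.exp (n * x) := by
    rw [Real.exp_nat_mul]
    exact pow_le_pow_left₀ (by linarith) (by linarith [Real.add_one_le_exp x]) n
  have h3 := Real.abs_exp_sub_one_le (x := n * x) (by rwa [abs_of_nonneg (by positivity)])
  rw [abs_of_nonneg (by positivity : (0 : ℝ) ≤ n * x)] at h3
  linarith [le_abs_self (Real.exp (n * x) - 1)]

theorem abs_exp_neg_mul_ceil_sub_le {p t : ℝ} (hp : 0 < p) (ht : 0 < t) :
    Real.exp (-(⌈t / p⌉₊ * p)) ≤ Real.exp (-t) ∧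
      |Real.exp (-(⌈t / p⌉₊ * p)) - Real.exp (-t)| ≤ p * Real.exp (-t) := by
  have h1 : t ≤ ⌈t / p⌉₊ * p := (div_le_iff₀ hp).1 (Nat.le_ceil _)
  have h2 : ⌈t / p⌉₊ * p ≤ t + p := by
    have := mul_le_mul_of_nonneg_right (Nat.ceil_lt_add_one (div_pos ht hp).le).le hp.le
    rwa [add_mul, div_mul_cancel₀ _ hp.ne', one_mul] at this
  have h3 : Real.exp (-(⌈t / p⌉₊ * p)) ≤ Real.exp (-t) := Real.exp_le_exp.2 (by linarith)
  refine ⟨h3, ?_⟩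
  rw [abs_sub_comm, abs_of_nonneg (by linarith)]
  have h4 : Real.exp (-t) * (1 - p) ≤ Real.exp (-(⌈t / p⌉₊ * p)) := by
    calc _ ≤ Real.exp (-t) * Real.exp (-p) := by
          gcongr
          linarith [Real.add_one_le_exp (-p)]
      _ = Real.exp (-t + -p) := (Real.exp_add _ _).symm
      _ ≤ _ := Real.exp_le_exp.2 (by linarith)
  linarith

/-! ### Perturbations of rank one operators. -/

section RankOne

variable {V : Type*} [NormedAddCommGroup V] [NormedSpace ℂ V]

/-- The case `n = 0` is excluded because `Q ^ 0 = 1` would leave the rank one term over. -/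
theorem ContinuousLinearMap.pow_eq_of_rankOne_add {P Q : V →L[ℂ] V} {φ : V} {ν : V →L[ℂ] ℂ}
    {z : ℂ} (hz : z ≠ 0) (h : z⁻¹ • P = ν.smulRight φ + Q) (hPφ : P φ = z • φ)
    (hνQ : ν.comp Q = 0) {n : ℕ} (hn : 0 < n) :
    P ^ n = z ^ n • (ν.smulRight φ + Q ^ n) := by
  have hP : P = z • (ν.smulRight φ + Q) := by rw [← h, smul_smul, mul_inv_cancel₀ hz, one_smul]
  induction n, hn using Nat.le_induction with
  | base => simpa using hP
  | succ n hn ih =>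
    obtain ⟨m, rfl⟩ := Nat.exists_eq_add_of_le' hn
    ext f
    have h0 : ν ((Q ^ (m + 1)) f) = 0 := by
      rw [pow_succ']; exact congrArg (fun l : V →L[ℂ] ℂ => l ((Q ^ m) f)) hνQ
    have hPy : ∀ y, ν y = 0 → P y = z • Q y := fun y hy => by rw [hP]; simp [hy]
    have h1 : P ((Q ^ (m + 1)) f) = z • (Q ^ (m + 1 + 1)) f := by
      rw [pow_succ' Q (m + 1)]
      exact hPy _ h0
    rw [pow_succ', ih]
    simp only [mul_apply_eq_comp, _root_.smul_apply,
      _root_.add_apply, ContinuousLinearMap.smulRight_apply, map_smul, map_add,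
      hPφ, h1]
    module

/-- `P` commutes with `P ^ N`, whose leading eigenspace is simple and separated from the rest by the
bound 1/2. Hence `P` preserves the eigenvector and the eigenfunctional. -/
theorem exists_decomposition_of_pow {P : V →L[ℂ] V} {N : ℕ} (hN : 0 < N) {z : ℂ} {u : V}
    {ν : V →L[ℂ] ℂ} (hz : ‖z - 1‖ ≤ 1 / 2) (hPu : (P ^ N) u = z • u)
    (hνP : ν.comp (P ^ N) = z • ν) (hνu : ν u = 1)
    (hQ : ‖z⁻¹ • P ^ N - ν.smulRight u‖ ≤ 1 / 2) :
    ∃ l : ℂ, l ≠ 0 ∧ P u = l • u ∧ ν.comp P = l • ν ∧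
      ∃ Q : V →L[ℂ] V, l⁻¹ • P = ν.smulRight u + Q ∧ Q u = 0 ∧ ν.comp Q = 0 ∧
        ‖Q ^ N‖ ≤ 1 / 2 ∧ ∀ k < N, ‖Q ^ k‖ ≤ 1 + 2 ^ k * ‖P ^ k‖ + ‖ν‖ * ‖u‖ := by
  have hz2 : 1 / 2 ≤ ‖z‖ := by
    have := norm_sub_norm_le (1 : ℂ) z
    rw [norm_one, norm_sub_rev] at this
    linarith
  have hz0 : z ≠ 0 := norm_pos_iff.1 (by linarith)
  have hcomm : ∀ f, (P ^ N) (P f) = P ((P ^ N) f) := fun f => by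
    rw [← mul_apply_eq_comp, ← mul_apply_eq_comp, ← pow_succ, ← pow_succ']
  have hνP' : ∀ f, ν ((P ^ N) f) = z * ν f := fun f =>
    congrArg (fun l : V →L[ℂ] ℂ => l f) hνP
  set q : V →L[ℂ] V := z⁻¹ • P ^ N - ν.smulRight u with hq
  have hqf : ∀ f, q f = z⁻¹ • (P ^ N) f - ν f • u := fun f => by
    simp only [hq, _root_.sub_apply, _root_.smul_apply, ContinuousLinearMap.smulRight_apply]
  have hPu' : P u = ν (P u) • u := by
    set w := P u - ν (P u) • u with hw
    have h1 : ν w = 0 := by simp [hw, hνu]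
    have h2 : (P ^ N) w = z • w := by
      rw [hw, map_sub, map_smul, hcomm, hPu, map_smul, smul_sub, smul_comm]
    -- A vector fixed by `q` vanishes since `‖q‖ ≤ 1 / 2`; the same argument on the dual side gives
    -- `hνPl`.
    have h3 : q w = w := by rw [hqf, h1, h2, inv_smul_smul₀ hz0, zero_smul, sub_zero]
    have h4 : ‖w‖ ≤ 1 / 2 * ‖w‖ := by
      conv_lhs => rw [← h3]
      exact q.le_of_opNorm_le hQ w
    have h5 : w = 0 := norm_le_zero_iff.1 (by linarith [norm_nonneg w])
    exact sub_eq_zero.1 h5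
  set l : ℂ := ν (P u) with hl
  have hlN : l ^ N = z := by
    have h1 : ∀ n : ℕ, (P ^ n) u = l ^ n • u := fun n => by
      induction n with
      | zero => simp
      | succ n ih => rw [pow_succ', mul_apply_eq_comp, ih, map_smul, hPu', smul_smul, pow_succ]
    have h2 := congrArg ν ((h1 N).symm.trans hPu)
    simpa [hνu] using h2
  have hνPl : ν.comp P = l • ν := by
    have h1 : (ν.comp P - l • ν).comp q = ν.comp P - l • ν := by
      ext f
      have h2 : ν (P ((P ^ N) f)) = z * ν (P f) := by rw [← hcomm, hνP']
      simp only [ContinuousLinearMap.comp_apply, _root_.sub_apply, _root_.smul_apply, hqf,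
        map_sub, map_smul, smul_eq_mul, hνP', h2, ← hl, hνu]
      field_simp
      ring
    have h3 : ‖ν.comp P - l • ν‖ ≤ ‖ν.comp P - l • ν‖ * (1 / 2) := by
      conv_lhs => rw [← h1]
      exact (ContinuousLinearMap.opNorm_comp_le _ _).trans (by gcongr)
    have h4 : ν.comp P - l • ν = 0 :=
      norm_le_zero_iff.1 (by linarith [norm_nonneg (ν.comp P - l • ν)])
    exact sub_eq_zero.1 h4
  have hl0 : l ≠ 0 := fun h => hz0 (by rw [← hlN, h, zero_pow hN.ne'])
  have hl2 : ‖l‖⁻¹ ≤ 2 := by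
    rw [inv_le_comm₀ (norm_pos_iff.2 hl0) (by norm_num)]
    by_contra! h
    have h1 : ‖l‖ ^ N ≤ ‖l‖ ^ 1 := pow_le_pow_of_le_one (norm_nonneg _) (by linarith) hN
    rw [← norm_pow, hlN, pow_one] at h1
    linarith
  set Q : V →L[ℂ] V := l⁻¹ • P - ν.smulRight u with hQdef
  have hdec : l⁻¹ • P = ν.smulRight u + Q := by rw [hQdef]; abel
  have hνPf : ∀ f, ν (P f) = l * ν f := fun f => congrArg (fun m : V →L[ℂ] ℂ => m f) hνPl
  have hνQ : ν.comp Q = 0 := by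
    ext f
    simp [hQdef, hνPf, hνu, hl0]
  have hpow : ∀ k, 0 < k → Q ^ k = (l⁻¹) ^ k • P ^ k - ν.smulRight u := fun k hk => by
    rw [ContinuousLinearMap.pow_eq_of_rankOne_add hl0 hdec hPu' hνQ hk, smul_smul, ← mul_pow,
      inv_mul_cancel₀ hl0, one_pow, one_smul]
    abel
  refine ⟨l, hl0, hPu', hνPl, Q, hdec, ?_, hνQ, ?_, fun k _ => ?_⟩
  · simp only [hQdef, _root_.sub_apply, _root_.smul_apply, ContinuousLinearMap.smulRight_apply]
    rw [hPu', inv_smul_smul₀ hl0, hνu, one_smul, sub_self]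
  · rw [hpow N hN, inv_pow, hlN]; exact hQ
  · rcases Nat.eq_zero_or_pos k with rfl | hk
    · have h1 : ‖(1 : V →L[ℂ] V)‖ ≤ 1 := ContinuousLinearMap.norm_id_le (𝕜 := ℂ) (E := V)
      rw [pow_zero]
      have : 0 ≤ 2 ^ 0 * ‖P ^ 0‖ + ‖ν‖ * ‖u‖ := by positivity
      linarith
    · rw [hpow k hk]
      have h1 : ‖(l⁻¹) ^ k • P ^ k‖ ≤ 2 ^ k * ‖P ^ k‖ := by
        rw [norm_smul, norm_pow, norm_inv]; gcongr
      have h2 := norm_sub_le_of_le h1 (ContinuousLinearMap.norm_smulRight_apply ν u).le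
      linarith

variable [CompleteSpace V]

theorem exists_resolvent_bound {S : V →L[ℂ] V} (hS : ‖S‖ ≤ 1 / 4) {z : ℂ} (hz : 1 / 2 ≤ ‖z‖) :
    ∃ R : V →L[ℂ] V, ‖R‖ ≤ 4 ∧ (∀ f, z • R f = f + S (R f)) ∧ ∀ f, z • R f = f + R (S f) := by
  have hmem : z ∈ resolventSet ℂ S := by
    apply spectrum.mem_resolventSet_of_norm_lt_mul
    have := ContinuousLinearMap.norm_id_le (𝕜 := ℂ) (E := V)
    have h1 : ‖(1 : V →L[ℂ] V)‖ ≤ 1 := this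
    nlinarith [norm_nonneg S, norm_nonneg (1 : V →L[ℂ] V)]
  obtain ⟨w, hw⟩ := hmem
  have hr : ∀ f, z • (↑w⁻¹ : V →L[ℂ] V) f = f + S ((↑w⁻¹ : V →L[ℂ] V) f) := fun f => by
    have := congrArg (fun l : V →L[ℂ] V => l f) w.mul_inv
    simp only [hw, Algebra.algebraMap_eq_smul_one, mul_apply_eq_comp,
      _root_.sub_apply, _root_.smul_apply,
      one_apply_eq_self] at this
    rw [← sub_eq_iff_eq_add]; exact this
  refine ⟨(↑w⁻¹ : V →L[ℂ] V), ?_, hr, fun f => ?_⟩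
  · refine ContinuousLinearMap.opNorm_le_bound _ (by norm_num) fun f => ?_
    have h1 := congrArg norm (hr f)
    rw [norm_smul] at h1
    have h2 := norm_add_le f (S ((↑w⁻¹ : V →L[ℂ] V) f))
    have h3 := S.le_of_opNorm_le hS ((↑w⁻¹ : V →L[ℂ] V) f)
    have h4 := mul_le_mul_of_nonneg_right hz (norm_nonneg ((↑w⁻¹ : V →L[ℂ] V) f))
    linarith
  · have := congrArg (fun l : V →L[ℂ] V => l f) w.inv_mul
    simp only [hw, Algebra.algebraMap_eq_smul_one, mul_apply_eq_comp,
      _root_.sub_apply, _root_.smul_apply,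
      one_apply_eq_self, map_sub, map_smul] at this
    rw [← sub_eq_iff_eq_add]; exact this

/-- The scalar equation for the leading eigenvalue of a small perturbation of a rank one
operator. -/
theorem exists_leading_eigenvalue {S : V →L[ℂ] V} {ν : V →L[ℂ] ℂ} {g : V}
    (hS : ‖S‖ ≤ 1 / 4) (hg : ‖ν g - 1‖ ≤ 1 / 4) (hsmall : ‖ν‖ * ‖g‖ * ‖S‖ ≤ 1 / 32) :
    ∃ z : ℂ, ‖z - 1‖ ≤ 1 / 2 ∧ ∃ R : V →L[ℂ] V, ‖R‖ ≤ 4 ∧ (∀ f, z • R f = f + S (R f)) ∧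
      (∀ f, z • R f = f + R (S f)) ∧ ν (R g) = 1 := by
  have hball : ∀ z : ℂ, z ∈ Metric.closedBall (1 : ℂ) (1 / 2) → 1 / 2 ≤ ‖z‖ := fun z hz => by
    rw [mem_closedBall_iff_norm] at hz
    have := norm_sub_norm_le (1 : ℂ) z
    rw [norm_one, norm_sub_rev] at this
    linarith
  choose! R hR4 hRr hRl using fun z hz => exists_resolvent_bound hS (hball z hz)
  -- With `R z = (z - S)⁻¹`, the vector `R z g` is an eigenvector of `ν ⊗ g + S` for `z` when `ν (R
  -- z g) = 1`. Multiplied by `z`, this condition reads `F z = z`.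
  let F : ℂ → ℂ := fun z => ν g + ν (S (R z g))
  have hbound : ∀ f, ‖f‖ ≤ 4 * ‖g‖ → ‖ν (S f)‖ ≤ 1 / 8 := fun f hf => by
    calc ‖ν (S f)‖ ≤ ‖ν‖ * (‖S‖ * (4 * ‖g‖)) := by
          refine (ν.le_opNorm _).trans ?_
          gcongr
          exact (S.le_opNorm _).trans (by gcongr)
      _ ≤ 1 / 8 := by linarith
  have hmaps : Set.MapsTo F (Metric.closedBall 1 (1 / 2)) (Metric.closedBall 1 (1 / 2)) := by
    intro z hz
    rw [mem_closedBall_iff_norm]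
    have h1 := hbound (R z g) ((R z).le_of_opNorm_le (hR4 z hz) g)
    calc ‖F z - 1‖ = ‖(ν g - 1) + ν (S (R z g))‖ := by congr 1; simp only [F]; ring
      _ ≤ 1 / 4 + 1 / 8 := norm_add_le_of_le hg h1
      _ ≤ 1 / 2 := by norm_num
  -- The resolvent identity, which makes `F` a contraction.
  have hsub : ∀ z ∈ Metric.closedBall (1 : ℂ) (1 / 2), ∀ w ∈ Metric.closedBall (1 : ℂ) (1 / 2),
      R z g - R w g = (w - z) • R z (R w g) := fun z hz w hw => by
    have h1 := hRl z hz (R w g)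
    have h2 := congrArg (R z) (hRr w hw g)
    simp only [map_smul, map_add] at h2
    rw [sub_smul, h2, h1]; abel
  have hcontr : ContractingWith (1 / 2) (hmaps.restrict F _ _) := by
    refine ⟨by norm_num, LipschitzWith.of_dist_le_mul fun z w => ?_⟩
    rw [Subtype.dist_eq, Subtype.dist_eq, dist_eq_norm, dist_eq_norm]
    simp only [Set.MapsTo.val_restrict_apply, F]
    have h1 : ν g + ν (S (R z g)) - (ν g + ν (S (R w g)))
        = ((w : ℂ) - z) * ν (S (R z (R w g))) := by
      rw [add_sub_add_left_eq_sub, ← map_sub, ← map_sub, hsub z z.2 w w.2]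
      simp
    have h2 : ‖ν (S (R z (R w g)))‖ ≤ 1 / 2 := by
      have h3 : ‖R z (R w g)‖ ≤ 4 * (4 * ‖g‖) :=
        ((R z).le_of_opNorm_le (hR4 z z.2) _).trans
          (by gcongr; exact (R w).le_of_opNorm_le (hR4 w w.2) g)
      calc ‖ν (S (R z (R w g)))‖ ≤ ‖ν‖ * (‖S‖ * (4 * (4 * ‖g‖))) := by
            refine (ν.le_opNorm _).trans ?_
            gcongr
            exact (S.le_opNorm _).trans (by gcongr)
        _ ≤ 1 / 2 := by linarith
    rw [h1, norm_mul, norm_sub_rev, mul_comm]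
    push_cast
    gcongr
  have h1mem : (1 : ℂ) ∈ Metric.closedBall (1 : ℂ) (1 / 2) :=
    Metric.mem_closedBall_self (by norm_num)
  obtain ⟨z, hz, hfix, -⟩ := hcontr.exists_fixedPoint' Metric.isClosed_closedBall.isComplete
    hmaps h1mem (edist_ne_top _ _)
  refine ⟨z, mem_closedBall_iff_norm.1 hz, R z, hR4 z hz, hRr z hz, hRl z hz, ?_⟩
  have hz0 : z ≠ 0 := norm_pos_iff.1 (by linarith [hball z hz])
  have h1 : ν g + ν (S (R z g)) = z := hfix
  have h2 := congrArg ν (hRr z hz g)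
  rw [map_smul, map_add, h1, smul_eq_mul] at h2
  exact mul_left_cancel₀ hz0 (by rw [h2, mul_one])

/-- Spectral decomposition of a small perturbation of a rank one operator. -/
theorem exists_rankOne_decomposition (n₀ G : ℝ) (hn₀ : 0 ≤ n₀) (hG : 0 ≤ G) :
    ∃ s > (0 : ℝ), ∀ (ν : V →L[ℂ] ℂ) (g : V) (B : V →L[ℂ] V), ‖ν‖ ≤ n₀ → ‖g‖ ≤ G →
      ‖ν g - 1‖ ≤ 1 / 4 → ‖B - ν.smulRight g‖ ≤ s →
      ∃ (z : ℂ) (u : V) (ν' : V →L[ℂ] ℂ), ‖z - 1‖ ≤ 1 / 2 ∧ B u = z • u ∧ ν'.comp B = z • ν' ∧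
        ν u = 1 ∧ ν' u = 1 ∧ ‖u‖ ≤ 4 * G ∧ ‖ν'‖ ≤ 12 * n₀ ∧
        ‖z⁻¹ • B - ν'.smulRight u‖ ≤ 1 / 2 := by
  -- Chosen so that the last chain of estimates ends with `d * ‖S‖ / 2`.
  set d : ℝ := 4 * (1 + 4 * n₀ * G) * (1 + 48 * n₀ * G) with hd
  have hx : 0 ≤ n₀ * G := by positivity
  have hd4 : 4 ≤ d := by rw [hd]; nlinarith
  have hd32 : 32 * (n₀ * G) ≤ d := by rw [hd]; nlinarith
  refine ⟨d⁻¹, by positivity, fun ν g B hν hg hνg hB => ?_⟩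
  set S : V →L[ℂ] V := B - ν.smulRight g with hSdef
  have hds : d * ‖S‖ ≤ 1 := by
    calc d * ‖S‖ ≤ d * d⁻¹ := by gcongr
      _ = 1 := mul_inv_cancel₀ (by positivity)
  have hBf : ∀ f, B f = ν f • g + S f := fun f => by simp [hSdef]
  have hS4 : ‖S‖ ≤ 1 / 4 := by nlinarith [norm_nonneg S]
  have hnGS : n₀ * G * ‖S‖ ≤ 1 / 32 := by nlinarith [norm_nonneg S]
  have hsmall : ‖ν‖ * ‖g‖ * ‖S‖ ≤ 1 / 32 := le_trans (by gcongr) hnGS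
  obtain ⟨z, hz1, R, hR4, hRr, hRl, hνR⟩ := exists_leading_eigenvalue hS4 hνg hsmall
  have hz : 1 / 2 ≤ ‖z‖ := by
    have := norm_sub_norm_le (1 : ℂ) z
    rw [norm_one, norm_sub_rev] at this
    linarith
  have hz' : ‖z‖ ≤ 3 / 2 := by
    have := norm_sub_norm_le z 1
    rw [norm_one] at this
    linarith
  have hz0 : z ≠ 0 := norm_pos_iff.1 (by linarith)
  have hu : ‖R g‖ ≤ 4 * G := (R.le_of_opNorm_le hR4 g).trans (by gcongr)
  have hνR4 : ‖ν.comp R‖ ≤ 4 * n₀ :=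
    (ν.opNorm_comp_le R).trans (by nlinarith [norm_nonneg ν, norm_nonneg R])
  have hleft : ∀ f, z * ν (R f) = ν f + ν (R (S f)) := fun f => by
    have := congrArg ν (hRl f)
    rwa [map_smul, map_add, smul_eq_mul] at this
  have hνRS : ∀ f, ‖ν (R (S f))‖ ≤ 4 * n₀ * ‖S‖ * ‖f‖ := fun f => by
    calc ‖ν (R (S f))‖ ≤ 4 * n₀ * ‖S f‖ := (ν.comp R).le_of_opNorm_le hνR4 (S f)
      _ ≤ 4 * n₀ * (‖S‖ * ‖f‖) := by gcongr; exact S.le_opNorm f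
      _ = _ := by ring
  -- `ν ∘ R` is a left eigenfunctional, and `c` is its value on the eigenvector `R g`. It stays away
  -- from 0 because `z c = 1 + ν (R (S (R g)))`.
  set c : ℂ := ν (R (R g)) with hc
  have hc3 : 1 / 3 ≤ ‖c‖ := by
    have h1 := hleft (R g)
    rw [hνR] at h1
    have h2 : ‖ν (R (S (R g)))‖ ≤ 1 / 2 := by
      calc _ ≤ 4 * n₀ * ‖S‖ * (4 * G) := (hνRS _).trans (by gcongr)
        _ ≤ 1 / 2 := by linarith
    have h3 : (1 : ℝ) ≤ ‖z‖ * ‖c‖ + 1 / 2 := by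
      calc (1 : ℝ) = ‖z * c - ν (R (S (R g)))‖ := by rw [h1]; simp
        _ ≤ ‖z‖ * ‖c‖ + 1 / 2 := norm_sub_le_of_le (norm_mul _ _).le h2
    nlinarith [norm_nonneg c]
  have hc0 : c ≠ 0 := norm_pos_iff.1 (by linarith)
  have hBu : B (R g) = z • R g := by rw [hBf, hνR, one_smul, hRr]
  have hν'norm : ‖c⁻¹ • ν.comp R‖ ≤ 12 * n₀ := by
    rw [norm_smul, norm_inv]
    have : ‖c‖⁻¹ ≤ 3 := by rw [inv_le_comm₀ (by linarith) (by norm_num)]; linarith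
    calc _ ≤ 3 * (4 * n₀) := by gcongr
      _ = _ := by ring
  refine ⟨z, R g, c⁻¹ • ν.comp R, hz1, hBu, ?_, hνR, ?_, hu, hν'norm, ?_⟩
  · ext f
    simp only [ContinuousLinearMap.comp_apply, _root_.smul_apply, smul_eq_mul]
    rw [hBf, map_add, map_add, map_smul, map_smul, hνR, mul_left_comm, hleft]
    simp
  · simp [← hc, hc0]
  · refine ContinuousLinearMap.opNorm_le_bound _ (by norm_num) fun f => ?_
    set ν' : V →L[ℂ] ℂ := c⁻¹ • ν.comp R with hν'
    -- On the kernel of `ν'` one has `ν w = -ν (R (S w))`, so both terms of `B w = ν w • g + S w`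
    -- are of order `‖S‖`.
    set w : V := f - ν' f • R g with hw
    have h1 : (z⁻¹ • B - ν'.smulRight (R g)) f = z⁻¹ • B w := by
      simp only [_root_.sub_apply, _root_.smul_apply,
        ContinuousLinearMap.smulRight_apply, hw, map_sub, map_smul, hBu, smul_sub]
      rw [smul_comm (ν' f) z, inv_smul_smul₀ hz0]
    have hν'w : ν (R w) = 0 := by
      have : ν (R w) = ν (R f) - c⁻¹ * ν (R f) * c := by
        simp [hw, hν', hc]
      rw [this]; field_simp; ring
    have hνw : ‖ν w‖ ≤ 4 * n₀ * ‖S‖ * ‖w‖ := by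
      have h2 := hleft w
      rw [hν'w, mul_zero] at h2
      rw [eq_neg_of_add_eq_zero_left h2.symm, norm_neg]
      exact hνRS w
    have hBw : ‖B w‖ ≤ (4 * n₀ * ‖S‖ * ‖w‖) * G + ‖S‖ * ‖w‖ := by
      rw [hBf]
      refine norm_add_le_of_le ?_ (S.le_opNorm w)
      rw [norm_smul]; gcongr
    have hwn : ‖w‖ ≤ ‖f‖ + 12 * n₀ * ‖f‖ * (4 * G) := by
      refine norm_sub_le_of_le le_rfl ?_
      rw [norm_smul]
      gcongr
      exact ν'.le_of_opNorm_le hν'norm f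
    have hzi : ‖z‖⁻¹ ≤ 2 := by rw [inv_le_comm₀ (by linarith) (by norm_num)]; linarith
    rw [h1, norm_smul, norm_inv]
    calc ‖z‖⁻¹ * ‖B w‖ ≤ 2 * ((4 * n₀ * ‖S‖ * ‖w‖) * G + ‖S‖ * ‖w‖) := by gcongr
      _ = 2 * ‖S‖ * (1 + 4 * n₀ * G) * ‖w‖ := by ring
      _ ≤ 2 * ‖S‖ * (1 + 4 * n₀ * G) * (‖f‖ + 12 * n₀ * ‖f‖ * (4 * G)) := by gcongr
      _ = (d * ‖S‖) * ‖f‖ / 2 := by rw [hd]; ring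
      _ ≤ 1 * ‖f‖ / 2 := by gcongr
      _ = 1 / 2 * ‖f‖ := by ring

end RankOne

/-! ### The unperturbed operator and the size of the perturbation. -/

namespace REPFO

variable {M V E : Type*} [MetricSpace M] [MeasurableSpace M] [BorelSpace M]
  [NormedAddCommGroup V] [NormedSpace ℂ V] [TopologicalSpace E] [Zero E] (S : REPFO M V E)

theorem ν₀_P_zero (f : V) : S.ν₀ (S.P 0 f) = S.ν₀ f := by
  rw [S.ν₀_eq, S.dist_P, S.ν₀_eq]; rfl

theorem P_zero_sub_P (ε : E) (f : V) : (S.P 0 - S.P ε) f = S.P 0 (S.mulA ε f) := by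
  rw [_root_.sub_apply, S.P_eq ε, map_sub]; abel

theorem ν₀_P_zero_sub_P (ε : E) (f : V) : S.ν₀ ((S.P 0 - S.P ε) f) = S.ν₀ (S.mulA ε f) := by
  rw [P_zero_sub_P, ν₀_P_zero]

theorem ν₀_φ₀ : S.ν₀ S.φ₀ = 1 := by
  have := S.probability_μ₀
  rw [S.ν₀_eq, S.dist_φ₀]; simp

theorem φ₀_ne_zero : S.φ₀ ≠ 0 := fun h => by
  have := S.ν₀_φ₀
  rw [h, map_zero] at this
  exact zero_ne_one this

theorem norm_φ₀_pos : 0 < ‖S.φ₀‖ := norm_pos_iff.2 S.φ₀_ne_zero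

theorem norm_P_pow_le (ε : E) (n : ℕ) : ‖S.P ε ^ n‖ ≤ 2 * S.D := by
  have hD := S.D_pos
  refine ContinuousLinearMap.opNorm_le_bound _ (by positivity) fun f => ?_
  have h1 := S.lasota_yorke ε f n
  have h2 : S.α ^ n ≤ 1 := pow_le_one₀ S.α_pos.le S.α_lt_one.le
  calc _ ≤ S.D * 1 * ‖f‖ + S.D * ‖f‖ := h1.trans (by gcongr; exact S.weak_le f)
    _ = _ := by ring

theorem P_zero_pow_φ₀ (n : ℕ) : (S.P 0 ^ n) S.φ₀ = S.φ₀ := by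
  induction n with
  | zero => simp
  | succ n ih => rw [pow_succ', mul_apply_eq_comp, ih, S.P_φ₀]

/-- If the seminorm vanished at the fixed vector `φ₀`, the Lasota–Yorke inequality would give `‖φ₀‖
≤ D α^n ‖φ₀‖` for all `n`. -/
theorem weak_φ₀_pos : 0 < S.weak S.φ₀ := by
  have hD := S.D_pos
  have hφ := S.norm_φ₀_pos
  by_contra! h
  have h1 : ∀ n : ℕ, ‖S.φ₀‖ ≤ S.D * S.α ^ n * ‖S.φ₀‖ := fun n => by
    have h2 := S.lasota_yorke 0 S.φ₀ n
    rw [P_zero_pow_φ₀] at h2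
    nlinarith
  have h2 : Tendsto (fun n : ℕ => S.D * S.α ^ n * ‖S.φ₀‖) atTop (𝓝 (S.D * 0 * ‖S.φ₀‖)) :=
    ((tendsto_pow_atTop_nhds_zero_of_lt_one S.α_pos.le S.α_lt_one).const_mul _).mul_const _
  have h3 := ge_of_tendsto' h2 h1
  simp only [mul_zero, zero_mul] at h3
  linarith

/-- The operator `Q₀ = P₀ - φ₀ ⊗ ν₀`. -/
noncomputable def Q₀ : V →L[ℂ] V := S.P 0 - S.ν₀.smulRight S.φ₀

theorem P_zero_eq : S.P 0 = S.ν₀.smulRight S.φ₀ + S.Q₀ := by rw [Q₀]; abel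

theorem ν₀_comp_P_zero : S.ν₀.comp (S.P 0) = S.ν₀ := by
  ext f; exact S.ν₀_P_zero f

theorem ν₀_comp_Q₀ : S.ν₀.comp S.Q₀ = 0 := by
  ext f
  simp [Q₀, ν₀_P_zero, ν₀_φ₀]

theorem Q₀_φ₀ : S.Q₀ S.φ₀ = 0 := by
  simp [Q₀, P_φ₀, ν₀_φ₀]

theorem P_zero_pow {n : ℕ} (hn : 0 < n) : S.P 0 ^ n = S.ν₀.smulRight S.φ₀ + S.Q₀ ^ n := by
  have := ContinuousLinearMap.pow_eq_of_rankOne_add (P := S.P 0) (Q := S.Q₀) one_ne_zero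
    (by rw [inv_one, one_smul, ← P_zero_eq]) (by rw [S.P_φ₀, one_smul]) S.ν₀_comp_Q₀ hn
  simpa using this

theorem tendsto_Q₀_pow [CompleteSpace V] : Tendsto (fun n => ‖S.Q₀ ^ n‖) atTop (𝓝 0) :=
  tendsto_pow_zero_of_spectralRadius_lt_one S.mixing

/-- `P₀^n f` tends to `ν₀(f) φ₀` in norm and its weak norm is at most `D |f|_w`. This turns weak
closeness of `P_ε` to `P₀` into `η_ε → 0`. -/
theorem exists_norm_ν₀_le_weak [CompleteSpace V] :
    ∃ c > (0 : ℝ), ∀ f, ‖S.ν₀ f‖ ≤ c * S.weak f := by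
  have hD := S.D_pos
  have hw := S.weak_φ₀_pos
  refine ⟨S.D / S.weak S.φ₀, by positivity, fun f => ?_⟩
  rw [div_mul_eq_mul_div, le_div_iff₀ hw]
  have h1 : ∀ᶠ n : ℕ in atTop, ‖S.ν₀ f‖ * S.weak S.φ₀ ≤ S.D * S.weak f + ‖S.Q₀ ^ n‖ * ‖f‖ := by
    filter_upwards [eventually_gt_atTop 0] with n hn
    have h2 : S.ν₀ f • S.φ₀ = (S.P 0 ^ n) f - (S.Q₀ ^ n) f := by
      rw [S.P_zero_pow hn]; simp
    calc ‖S.ν₀ f‖ * S.weak S.φ₀ = S.weak (S.ν₀ f • S.φ₀) := (map_smul_eq_mul S.weak _ _).symm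
      _ ≤ S.weak ((S.P 0 ^ n) f) + S.weak ((S.Q₀ ^ n) f) := by
        rw [h2]; exact map_sub_le_add S.weak _ _
      _ ≤ _ := add_le_add (S.weak_bound 0 f n)
        ((S.weak_le _).trans (ContinuousLinearMap.le_opNorm _ _))
  have h3 : Tendsto (fun n : ℕ => S.D * S.weak f + ‖S.Q₀ ^ n‖ * ‖f‖) atTop
      (𝓝 (S.D * S.weak f + 0 * ‖f‖)) := (S.tendsto_Q₀_pow.mul_const _).const_add _
  rw [zero_mul, add_zero] at h3
  exact ge_of_tendsto h3 h1

theorem norm_ν₀_P_zero_sub_P_le (ε : E) (f : V) :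
    ‖S.ν₀ ((S.P 0 - S.P ε) f)‖ ≤ S.η ε * ‖f‖ :=
  (S.ν₀.comp (S.P 0 - S.P ε)).le_opNorm f

theorem η_nonneg (ε : E) : 0 ≤ S.η ε := norm_nonneg _

theorem size_nonneg (ε : E) : 0 ≤ S.size ε := by
  have h := (apply_nonneg S.weak _).trans (S.size_bound ε S.φ₀)
  exact nonneg_of_mul_nonneg_left h S.norm_φ₀_pos

theorem tendsto_η [CompleteSpace V] : Tendsto S.η (𝓝[≠] 0) (𝓝 0) := by
  obtain ⟨c, hc, h⟩ := S.exists_norm_ν₀_le_weak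
  have hle : ∀ ε, S.η ε ≤ c * S.size ε := fun ε => by
    refine ContinuousLinearMap.opNorm_le_bound _ (mul_nonneg hc.le (S.size_nonneg ε)) fun f => ?_
    calc _ ≤ c * S.weak ((S.P 0 - S.P ε) f) := h _
      _ = c * S.weak (S.P ε f - S.P 0 f) := by rw [_root_.sub_apply, map_sub_rev]
      _ ≤ c * (S.size ε * ‖f‖) := by gcongr; exact S.size_bound ε f
      _ = _ := by ring
  have := S.size_tendsto.const_mul c
  rw [mul_zero] at this
  exact squeeze_zero S.η_nonneg hle this

/-! ### Duality, survival probabilities and positivity. -/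

/-- The dual of `P_ε`: composition with `T`, cut off to the complement of the hole. -/
noncomputable def survive (ε : E) (h : S.test) : S.test :=
  ⟨(h : M → ℂ) ∘ S.T, S.test_comp h h.2⟩ -
    ⟨(S.A ε).indicator ((h : M → ℂ) ∘ S.T), S.test_indicator ε _ (S.test_comp h h.2)⟩

/-- The dual of `P₀ - P_ε`: composition with `T`, cut off to the hole. -/
noncomputable def absorb (ε : E) (h : S.test) : S.test :=
  ⟨(S.A ε).indicator ((h : M → ℂ) ∘ S.T), S.test_indicator ε _ (S.test_comp h h.2)⟩

/-- The test function `1`. -/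
def oneTest : S.test := ⟨fun _ => 1, S.test_one⟩

open Classical in
theorem survive_apply (ε : E) (h : S.test) (x : M) :
    (S.survive ε h : M → ℂ) x = if x ∈ S.A ε then 0 else (h : M → ℂ) (S.T x) := by
  simp only [survive, Submodule.coe_sub, Pi.sub_apply, Set.indicator_apply, Function.comp_apply]
  split_ifs <;> simp

open Classical in
theorem absorb_apply (ε : E) (h : S.test) (x : M) :
    (S.absorb ε h : M → ℂ) x = if x ∈ S.A ε then (h : M → ℂ) (S.T x) else 0 := by
  simp [absorb, Set.indicator_apply]

theorem dist_P_apply (ε : E) (f : V) (h : S.test) :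
    S.dist (S.P ε f) h = S.dist f (S.survive ε h) := by
  rw [S.P_eq, S.dist_P, map_sub, LinearMap.sub_apply, S.dist_mulA, ← map_sub]
  rfl

theorem dist_P_pow (ε : E) (n : ℕ) (f : V) (h : S.test) :
    S.dist ((S.P ε ^ n) f) h = S.dist f ((S.survive ε)^[n] h) := by
  induction n generalizing h with
  | zero => simp
  | succ n ih => rw [pow_succ', mul_apply_eq_comp, dist_P_apply, ih, Function.iterate_succ_apply]

theorem dist_P_zero_sub_P (ε : E) (f : V) (h : S.test) :
    S.dist ((S.P 0 - S.P ε) f) h = S.dist f (S.absorb ε h) := by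
  rw [P_zero_sub_P, S.dist_P, S.dist_mulA]; rfl

theorem Δ_eq (ε : E) : S.Δ ε = S.μ₀.real (S.A ε) := by
  have hone : S.absorb ε S.oneTest = (S.A ε).indicator fun _ => (1 : ℂ) := by
    ext x; simp only [absorb_apply]; rfl
  rw [Δ, S.ν₀_eq, dist_P_zero_sub_P, S.dist_φ₀]
  erw [hone]
  rw [integral_indicator_const _ (S.measurableSet_A ε)]
  simp

open Classical in
theorem survive_iterate_one (ε : E) (n : ℕ) (x : M) :
    ((S.survive ε)^[n] S.oneTest : M → ℂ) x =
      {x | ∀ i < n, S.T^[i] x ∉ S.A ε}.indicator (fun _ => (1 : ℂ)) x := by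
  induction n generalizing x with
  | zero => simp [oneTest]
  | succ n ih =>
    rw [Function.iterate_succ_apply', survive_apply, ih]
    simp only [Set.indicator_apply, Set.mem_ofPred_eq]
    have : (∀ i < n + 1, S.T^[i] x ∉ S.A ε) ↔
        x ∉ S.A ε ∧ ∀ i < n, S.T^[i] (S.T x) ∉ S.A ε := by
      rw [Nat.forall_lt_succ_left']
      simp only [Function.iterate_zero, id, Function.iterate_succ_apply]
    simp only [this]
    by_cases h : x ∈ S.A ε <;> simp [h]

/-- `ν₀(P_εⁿ φ₀)` is the probability not to hit the hole before time `n`. -/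
theorem ν₀_P_pow_φ₀ (ε : E) (n : ℕ) :
    S.ν₀ ((S.P ε ^ n) S.φ₀) = S.μ₀.real {x | ∀ i < n, S.T^[i] x ∉ S.A ε} := by
  have hmeas : MeasurableSet {x | ∀ i < n, S.T^[i] x ∉ S.A ε} := by
    have : {x | ∀ i < n, S.T^[i] x ∉ S.A ε} = ⋂ i, ⋂ (_ : i < n), (S.T^[i] ⁻¹' S.A ε)ᶜ := by
      ext; simp
    rw [this]
    exact MeasurableSet.iInter fun i => MeasurableSet.iInter fun _ =>
      ((S.measurable_T.iterate i) (S.measurableSet_A ε)).compl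
  have h1 : S.ν₀ ((S.P ε ^ n) S.φ₀) = ∫ x, ((S.survive ε)^[n] S.oneTest : M → ℂ) x ∂S.μ₀ := by
    rw [S.ν₀_eq, dist_P_pow, S.dist_φ₀]; rfl
  rw [h1]
  simp_rw [survive_iterate_one]
  rw [integral_indicator_const _ hmeas]
  simp

theorem τ_ge_iff (ε : E) (s : ℝ) (x : M) :
    (s : EReal) ≤ S.τ ε x ↔ ∀ i < ⌈s⌉₊, S.T^[i] x ∉ S.A ε := by
  simp only [τ, le_iInf_iff, EReal.coe_le_coe_iff]
  refine ⟨fun h i hi hA => ?_, fun h i hA => ?_⟩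
  · exact absurd (h i hA) (not_le.2 (Nat.lt_ceil.1 hi))
  · by_contra! hi
    exact h i (Nat.lt_ceil.2 hi) hA

/-- The action of `φ₀` is integration against a positive measure. This is the source of `q_{k,ε} ≥
0` and of `∑_{k<n} q_{k,ε} ≤ 1`. -/
theorem exists_nonneg_integral_φ₀ (h : S.test)
    (hh : ∀ x, ∃ r : ℝ, 0 ≤ r ∧ (h : M → ℂ) x = r) : ∃ r : ℝ, 0 ≤ r ∧ S.dist S.φ₀ h = r := by
  choose r hr hrx using hh
  refine ⟨∫ x, r x ∂S.μ₀, integral_nonneg hr, ?_⟩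
  rw [S.dist_φ₀]
  simp_rw [hrx]
  exact integral_ofReal

theorem survive_nonneg (ε : E) (h : S.test)
    (hh : ∀ x, ∃ r : ℝ, 0 ≤ r ∧ (h : M → ℂ) x = r) (x : M) :
    ∃ r : ℝ, 0 ≤ r ∧ (S.survive ε h : M → ℂ) x = r := by
  rw [survive_apply]
  split_ifs
  exacts [⟨0, le_rfl, by simp⟩, hh _]

theorem absorb_nonneg (ε : E) (h : S.test)
    (hh : ∀ x, ∃ r : ℝ, 0 ≤ r ∧ (h : M → ℂ) x = r) (x : M) :
    ∃ r : ℝ, 0 ≤ r ∧ (S.absorb ε h : M → ℂ) x = r := by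
  rw [absorb_apply]
  split_ifs
  exacts [hh _, ⟨0, le_rfl, by simp⟩]

theorem survive_iterate_nonneg (ε : E) (n : ℕ) (h : S.test)
    (hh : ∀ x, ∃ r : ℝ, 0 ≤ r ∧ (h : M → ℂ) x = r) (x : M) :
    ∃ r : ℝ, 0 ≤ r ∧ ((S.survive ε)^[n] h : M → ℂ) x = r := by
  induction n generalizing x with
  | zero => exact hh x
  | succ n ih => rw [Function.iterate_succ_apply']; exact S.survive_nonneg ε _ ih x

theorem oneTest_nonneg (x : M) : ∃ r : ℝ, 0 ≤ r ∧ (S.oneTest : M → ℂ) x = r :=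
  ⟨1, zero_le_one, by simp [oneTest]⟩

theorem exists_nonneg_q (k : ℕ) (ε : E) : ∃ r : ℝ, 0 ≤ r ∧ S.q k ε = r := by
  have h1 : S.ν₀ ((S.P 0 - S.P ε) ((S.P ε ^ k) ((S.P 0 - S.P ε) S.φ₀))) =
      S.dist S.φ₀ (S.absorb ε ((S.survive ε)^[k] (S.absorb ε S.oneTest))) := by
    rw [S.ν₀_eq, dist_P_zero_sub_P, dist_P_pow, dist_P_zero_sub_P]; rfl
  obtain ⟨r, hr, h2⟩ := S.exists_nonneg_integral_φ₀ _ (S.absorb_nonneg ε _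
    (S.survive_iterate_nonneg ε k _ (S.absorb_nonneg ε _ S.oneTest_nonneg)))
  refine ⟨r / S.μ₀.real (S.A ε), div_nonneg hr measureReal_nonneg, ?_⟩
  rw [q, h1, h2, Δ_eq]; push_cast; rfl

/-- Telescoping: invariance of `φ₀` gives `P_ε^k φ₀ - P_ε^{k+1} φ₀ = P_ε^k (P₀ - P_ε) φ₀`. -/
theorem sub_P_pow_φ₀ (ε : E) (n : ℕ) : (S.P ε ^ n) S.φ₀ =
    S.φ₀ - ∑ k ∈ Finset.range n, (S.P ε ^ k) ((S.P 0 - S.P ε) S.φ₀) := by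
  induction n with
  | zero => simp
  | succ n ih =>
    rw [Finset.sum_range_succ, ← sub_sub, ← ih, _root_.sub_apply, S.P_φ₀, map_sub, pow_succ,
      mul_apply_eq_comp]
    abel

theorem ν₀_sub_P_pow_φ₀ {ε : E} (hΔ : S.Δ ε ≠ 0) (n : ℕ) :
    S.ν₀ ((S.P 0 - S.P ε) ((S.P ε ^ n) S.φ₀)) =
      S.Δ ε * (1 - ∑ k ∈ Finset.range n, S.q k ε) := by
  rw [sub_P_pow_φ₀, map_sub, map_sub, map_sum, map_sum, mul_sub, Finset.mul_sum, mul_one]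
  congr 1
  refine Finset.sum_congr rfl fun k _ => ?_
  rw [q, mul_div_cancel₀ _ hΔ]

theorem exists_nonneg_one_sub_sum_q {ε : E} (hΔ : S.Δ ε ≠ 0) (n : ℕ) :
    ∃ r : ℝ, 0 ≤ r ∧ 1 - ∑ k ∈ Finset.range n, S.q k ε = r := by
  have h1 : S.ν₀ ((S.P 0 - S.P ε) ((S.P ε ^ n) S.φ₀)) =
      S.dist S.φ₀ ((S.survive ε)^[n] (S.absorb ε S.oneTest)) := by
    rw [S.ν₀_eq, dist_P_zero_sub_P, dist_P_pow]; rfl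
  obtain ⟨r, hr, h2⟩ := S.exists_nonneg_integral_φ₀ _
    (S.survive_iterate_nonneg ε n _ (S.absorb_nonneg ε _ S.oneTest_nonneg))
  refine ⟨r / S.μ₀.real (S.A ε), div_nonneg hr measureReal_nonneg, ?_⟩
  rw [S.ν₀_sub_P_pow_φ₀ hΔ, h2] at h1
  rw [eq_comm]; push_cast
  rw [← Δ_eq, div_eq_iff hΔ, mul_comm, h1]

/-- The regularity assumption after taking the supremum over `f`. The factor `m` is kept inside the
functional, which avoids dividing by it. -/
theorem exists_η_mul_norm_le : ∃ K : ℝ, 0 ≤ K ∧ ∀ ε,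
    S.η ε * ‖(S.P 0 - S.P ε) S.φ₀‖ ≤ K * ‖S.Δ ε‖ := by
  obtain ⟨K, hK⟩ := S.regular
  refine ⟨‖S.P 0‖ * |K|, by positivity, fun ε => ?_⟩
  set m := ‖S.mulA ε S.φ₀‖ with hm
  have h1 : ‖(m : ℂ) • S.ν₀.comp (S.P 0 - S.P ε)‖ ≤ |K| * ‖S.Δ ε‖ := by
    refine ContinuousLinearMap.opNorm_le_bound _ (by positivity) fun f => ?_
    have h2 := hK ε f
    rw [← ν₀_P_zero_sub_P, ← ν₀_P_zero_sub_P, ← hm] at h2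
    rw [_root_.smul_apply, norm_smul, Complex.norm_real, Real.norm_of_nonneg (norm_nonneg _), mul_comm,
      ContinuousLinearMap.comp_apply]
    calc _ ≤ K * ‖f‖ * ‖S.Δ ε‖ := h2
      _ ≤ |K| * ‖f‖ * ‖S.Δ ε‖ := by gcongr; exact le_abs_self K
      _ = _ := by ring
  rw [norm_smul, Complex.norm_real, Real.norm_of_nonneg (norm_nonneg _)] at h1
  calc S.η ε * ‖(S.P 0 - S.P ε) S.φ₀‖ ≤ S.η ε * (‖S.P 0‖ * m) := by
        gcongr
        · exact S.η_nonneg ε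
        · rw [P_zero_sub_P]; exact (S.P 0).le_opNorm _
    _ = ‖S.P 0‖ * (m * S.η ε) := by ring
    _ ≤ ‖S.P 0‖ * (|K| * ‖S.Δ ε‖) := mul_le_mul_of_nonneg_left h1 (norm_nonneg _)
    _ = _ := by ring

theorem norm_ν₀_P_pow_φ₀_sub_one_le (ε : E) (n : ℕ) :
    ‖S.ν₀ ((S.P ε ^ n) S.φ₀) - 1‖ ≤ 2 * S.D * ‖S.φ₀‖ * (n * S.η ε) := by
  induction n with
  | zero => simp [S.ν₀_φ₀]
  | succ n ih =>
    have h1 : S.ν₀ ((S.P ε ^ (n + 1)) S.φ₀) - 1 = (S.ν₀ ((S.P ε ^ n) S.φ₀) - 1) -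
        S.ν₀ ((S.P 0 - S.P ε) ((S.P ε ^ n) S.φ₀)) := by
      rw [_root_.sub_apply, map_sub, S.ν₀_P_zero, pow_succ', mul_apply_eq_comp]; ring
    have h2 : ‖S.ν₀ ((S.P 0 - S.P ε) ((S.P ε ^ n) S.φ₀))‖ ≤ S.η ε * (2 * S.D * ‖S.φ₀‖) :=
      (S.norm_ν₀_P_zero_sub_P_le ε _).trans (mul_le_mul_of_nonneg_left
        ((S.P ε ^ n).le_of_opNorm_le (S.norm_P_pow_le ε n) _) (S.η_nonneg ε))
    rw [h1]
    refine (norm_sub_le_of_le ih h2).trans_eq ?_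
    push_cast; ring

end REPFO

/-! ### Existence of a leading decomposition. -/

namespace REPFO

variable {M V E : Type*} [MetricSpace M] [MeasurableSpace M] [BorelSpace M]
  [NormedAddCommGroup V] [NormedSpace ℂ V] [TopologicalSpace E] [Zero E] (S : REPFO M V E)

theorem exists_weak_P_pow_sub_le (m : ℕ) :
    ∃ C : ℝ, 0 ≤ C ∧ ∀ ε f, S.weak ((S.P ε ^ m - S.P 0 ^ m) f) ≤ C * S.size ε * ‖f‖ := by
  have hD := S.D_pos
  induction m with
  | zero => exact ⟨0, le_rfl, fun ε f => by simp⟩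
  | succ m ih =>
    obtain ⟨C, hC, h⟩ := ih
    refine ⟨S.D + C * (2 * S.D), by positivity, fun ε f => ?_⟩
    have hs := S.size_nonneg ε
    have h1 : (S.P ε ^ (m + 1) - S.P 0 ^ (m + 1)) f =
        (S.P ε ^ m) (S.P ε f - S.P 0 f) + (S.P ε ^ m - S.P 0 ^ m) (S.P 0 f) := by
      simp only [_root_.sub_apply, pow_succ, mul_apply_eq_comp, map_sub]; abel
    have h2 : ‖S.P 0 f‖ ≤ 2 * S.D * ‖f‖ := by
      have := (S.P 0).le_of_opNorm_le (by simpa using S.norm_P_pow_le 0 1) f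
      exact this
    calc _ ≤ S.weak ((S.P ε ^ m) (S.P ε f - S.P 0 f))
          + S.weak ((S.P ε ^ m - S.P 0 ^ m) (S.P 0 f)) := by rw [h1]; exact map_add_le_add _ _ _
      _ ≤ S.D * (S.size ε * ‖f‖) + C * S.size ε * (2 * S.D * ‖f‖) := by
        refine add_le_add ((S.weak_bound _ _ _).trans ?_) ((h _ _).trans ?_)
        · gcongr; exact S.size_bound ε f
        · gcongr
      _ = _ := by ring

/-- The difference splits as `P_ε^n (P_ε^m - P₀^m) + P_ε^n Q₀^m`. The second term is small by
mixing. In the first, the Lasota–Yorke inequality contracts the strong norm by `α^n` and leaves the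
weak norm, which is `O(π_ε)` for fixed `m`. So `m` and `n` are fixed before `ε`. -/
theorem eventually_norm_P_pow_sub_rankOne_le [CompleteSpace V] {s : ℝ} (hs : 0 < s) :
    ∃ N > 0, ∃ n : ℕ, ∀ᶠ ε in 𝓝[≠] (0 : E),
      ‖S.P ε ^ N - S.ν₀.smulRight ((S.P ε ^ n) S.φ₀)‖ ≤ s ∧
      ‖S.ν₀ ((S.P ε ^ n) S.φ₀) - 1‖ ≤ 1 / 4 := by
  have hD := S.D_pos
  obtain ⟨m, hm, hm0⟩ : ∃ m, 2 * S.D * ‖S.Q₀ ^ m‖ < s / 3 ∧ 0 < m := by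
    have := S.tendsto_Q₀_pow.const_mul (2 * S.D)
    rw [mul_zero] at this
    exact ((this.eventually_lt_const (by positivity : 0 < s / 3)).and
      (eventually_gt_atTop 0)).exists
  obtain ⟨n, hn⟩ : ∃ n : ℕ, S.D * (4 * S.D) * S.α ^ n < s / 3 := by
    have := (tendsto_pow_atTop_nhds_zero_of_lt_one S.α_pos.le S.α_lt_one).const_mul
      (S.D * (4 * S.D))
    rw [mul_zero] at this
    exact (this.eventually_lt_const (by positivity : 0 < s / 3)).exists
  obtain ⟨C, hC, hCw⟩ := S.exists_weak_P_pow_sub_le m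
  obtain ⟨C', hC', hCw'⟩ := S.exists_weak_P_pow_sub_le n
  obtain ⟨c, hc, hcw⟩ := S.exists_norm_ν₀_le_weak
  refine ⟨n + m, by omega, n, ?_⟩
  have ht1 : Tendsto (fun ε => S.D * C * S.size ε) (𝓝[≠] 0) (𝓝 0) := by
    simpa using S.size_tendsto.const_mul (S.D * C)
  have ht2 : Tendsto (fun ε => c * C' * ‖S.φ₀‖ * S.size ε) (𝓝[≠] 0) (𝓝 0) := by
    simpa using S.size_tendsto.const_mul (c * C' * ‖S.φ₀‖)
  filter_upwards [ht1.eventually_lt_const (by positivity : 0 < s / 3),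
    ht2.eventually_lt_const (by norm_num : (0 : ℝ) < 1 / 4)] with ε h1 h2
  constructor
  · have hsplit : S.P ε ^ (n + m) - S.ν₀.smulRight ((S.P ε ^ n) S.φ₀) =
        S.P ε ^ n * (S.P ε ^ m - S.P 0 ^ m) + S.P ε ^ n * S.Q₀ ^ m := by
      rw [← mul_add, S.P_zero_pow hm0, sub_add_eq_add_sub, add_sub_add_right_eq_sub, mul_sub,
        ← pow_add]
      congr 1
      ext f
      simp
    have hfirst : ‖S.P ε ^ n * (S.P ε ^ m - S.P 0 ^ m)‖ ≤ s / 3 + s / 3 := by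
      refine ContinuousLinearMap.opNorm_le_bound _ (by positivity) fun f => ?_
      have h3 : ‖(S.P ε ^ m - S.P 0 ^ m) f‖ ≤ 4 * S.D * ‖f‖ := by
        refine ContinuousLinearMap.le_of_opNorm_le _ ?_ f
        exact (norm_sub_le_of_le (S.norm_P_pow_le ε m) (S.norm_P_pow_le 0 m)).trans
          (by linarith)
      have hα := S.α_pos
      calc _ ≤ S.D * S.α ^ n * ‖(S.P ε ^ m - S.P 0 ^ m) f‖
            + S.D * S.weak ((S.P ε ^ m - S.P 0 ^ m) f) := S.lasota_yorke ε _ n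
        _ ≤ S.D * S.α ^ n * (4 * S.D * ‖f‖) + S.D * (C * S.size ε * ‖f‖) := by
          gcongr; exact hCw ε f
        _ = (S.D * (4 * S.D) * S.α ^ n + S.D * C * S.size ε) * ‖f‖ := by ring
        _ ≤ _ := by gcongr
    rw [hsplit]
    have hsecond : ‖S.P ε ^ n * S.Q₀ ^ m‖ ≤ s / 3 :=
      (norm_mul_le _ _).trans ((mul_le_mul_of_nonneg_right (S.norm_P_pow_le ε n)
        (norm_nonneg _)).trans hm.le)
    exact (norm_add_le_of_le hfirst hsecond).trans (by linarith)
  · have h3 : S.ν₀ ((S.P ε ^ n) S.φ₀) - 1 = S.ν₀ ((S.P ε ^ n - S.P 0 ^ n) S.φ₀) := by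
      rw [_root_.sub_apply, map_sub, P_zero_pow_φ₀, ν₀_φ₀]
    rw [h3]
    calc _ ≤ c * (C' * S.size ε * ‖S.φ₀‖) := (hcw _).trans (by gcongr; exact hCw' ε _)
      _ = c * C' * ‖S.φ₀‖ * S.size ε := by ring
      _ ≤ _ := h2.le

/-- The leading spectral data of a single operator `P_ε`. -/
theorem eventually_exists_leading_data [CompleteSpace V] :
    ∃ c : ℝ, ∃ C > (0 : ℝ), ∃ ρ : ℝ, 0 < ρ ∧ ρ < 1 ∧ ∀ᶠ ε in 𝓝[≠] (0 : E),
      ∃ (l : ℂ) (φ : V) (ν : V →L[ℂ] ℂ) (Q : V →L[ℂ] V), l ≠ 0 ∧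
        l⁻¹ • S.P ε = ν.smulRight φ + Q ∧ S.P ε φ = l • φ ∧ ν.comp (S.P ε) = l • ν ∧
        Q φ = 0 ∧ ν.comp Q = 0 ∧ S.ν₀ φ = 1 ∧ ‖φ‖ ≤ c ∧ ∀ n, ‖Q ^ n‖ ≤ C * ρ ^ n := by
  have hD := S.D_pos
  set G : ℝ := 2 * S.D * ‖S.φ₀‖ with hG
  have hG0 : 0 ≤ G := by positivity
  obtain ⟨s, hs, hrank⟩ := exists_rankOne_decomposition (V := V) ‖S.ν₀‖ G (norm_nonneg _) hG0
  obtain ⟨N, hN, n, hev⟩ := S.eventually_norm_P_pow_sub_rankOne_le hs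
  obtain ⟨C, hC, ρ, hρ0, hρ1, hgeom⟩ := exists_geometric_bound_of_submultiplicative hN
    (1 + 2 ^ N * (2 * S.D) + 12 * ‖S.ν₀‖ * (4 * G))
  refine ⟨4 * G, C, hC, ρ, hρ0, hρ1, ?_⟩
  filter_upwards [hev] with ε hε
  obtain ⟨z, u, ν', hz, hPu, hνP, hνu, hν'u, hu, hν', hQ⟩ := hrank S.ν₀ ((S.P ε ^ n) S.φ₀)
    (S.P ε ^ N) le_rfl ((S.P ε ^ n).le_of_opNorm_le (S.norm_P_pow_le ε n) _) hε.2 hε.1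
  obtain ⟨l, hl, hPl, hνl, Q, hdec, hQu, hνQ, hQN, hQk⟩ :=
    exists_decomposition_of_pow hN hz hPu hνP hν'u hQ
  refine ⟨l, u, ν', Q, hl, hdec, hPl, hνl, hQu, hνQ, hνu, hu,
    hgeom (fun k => ‖Q ^ k‖) (fun _ => norm_nonneg _) (norm_pow_add_le Q) (fun k hk => ?_) hQN⟩
  refine (hQk k hk).trans ?_
  have h1 : (2 : ℝ) ^ k ≤ 2 ^ N := pow_le_pow_right₀ (by norm_num) hk.le
  gcongr
  exact S.norm_P_pow_le ε k

theorem exists_decomposition [CompleteSpace V] :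
    ∃ U ∈ 𝓝 (0 : E), Nonempty (S.Decomposition U) := by
  classical
  obtain ⟨c, C, hC, ρ, hρ0, hρ1, hev⟩ := S.eventually_exists_leading_data
  obtain ⟨C', hC', ρ', hρ0', hρ1', hgeom⟩ := exists_geometric_bound_of_tendsto_zero
    (fun n => norm_nonneg (S.Q₀ ^ n)) (norm_pow_add_le S.Q₀) S.tendsto_Q₀_pow
  set G : Set E := {ε | ∃ (l : ℂ) (φ : V) (ν : V →L[ℂ] ℂ) (Q : V →L[ℂ] V), l ≠ 0 ∧
    l⁻¹ • S.P ε = ν.smulRight φ + Q ∧ S.P ε φ = l • φ ∧ ν.comp (S.P ε) = l • ν ∧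
    Q φ = 0 ∧ ν.comp Q = 0 ∧ S.ν₀ φ = 1 ∧ ‖φ‖ ≤ c ∧ ∀ n, ‖Q ^ n‖ ≤ C * ρ ^ n} with hGdef
  have hG : insert 0 G ∈ 𝓝 (0 : E) := insert_mem_nhds_iff.2 hev
  have hdata : ∀ ε, ∃ (l : ℂ) (φ : V) (ν : V →L[ℂ] ℂ) (Q : V →L[ℂ] V),
      (ε = 0 → l = 1 ∧ φ = S.φ₀ ∧ ν = S.ν₀) ∧ (ε ∈ insert 0 G → l ≠ 0 ∧
      l⁻¹ • S.P ε = ν.smulRight φ + Q ∧ S.P ε φ = l • φ ∧ ν.comp (S.P ε) = l • ν ∧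
      Q φ = 0 ∧ ν.comp Q = 0 ∧ S.ν₀ φ = 1 ∧ ‖φ‖ ≤ max c ‖S.φ₀‖ ∧
      ∀ n, ‖Q ^ n‖ ≤ C * ρ ^ n + C' * ρ' ^ n) := by
    intro ε
    rcases eq_or_ne ε 0 with rfl | hε
    · refine ⟨1, S.φ₀, S.ν₀, S.Q₀, fun _ => ⟨rfl, rfl, rfl⟩, fun _ => ⟨one_ne_zero, ?_, ?_, ?_,
        S.Q₀_φ₀, S.ν₀_comp_Q₀, S.ν₀_φ₀, le_max_right _ _, fun n => ?_⟩⟩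
      · rw [inv_one, one_smul, ← P_zero_eq]
      · rw [one_smul, S.P_φ₀]
      · rw [one_smul, ν₀_comp_P_zero]
      · exact (hgeom n).trans (le_add_of_nonneg_left (by positivity))
    · by_cases hεG : ε ∈ G
      · obtain ⟨l, φ, ν, Q, h1, h2, h3, h4, h5, h6, h7, h8, h9⟩ := hεG
        exact ⟨l, φ, ν, Q, fun h => absurd h hε, fun _ => ⟨h1, h2, h3, h4, h5, h6, h7,
          h8.trans (le_max_left _ _),
          fun n => (h9 n).trans (le_add_of_nonneg_right (by positivity))⟩⟩
      · exact ⟨1, 0, 0, 0, fun h => absurd h hε, fun h => absurd h (by simp [hε, hεG])⟩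
  choose l φ ν Q h0 hdata using hdata
  refine ⟨insert 0 G, hG, ⟨{
    eigenvalue := l
    φ := φ
    ν := ν
    Q := Q
    eigenvalue_zero := (h0 0 rfl).1
    φ_zero := (h0 0 rfl).2.1
    ν_zero := (h0 0 rfl).2.2
    eigenvalue_ne := fun ε hε => (hdata ε hε).1
    decomp := fun ε hε => (hdata ε hε).2.1
    P_φ := fun ε hε => (hdata ε hε).2.2.1
    ν_P := fun ε hε => (hdata ε hε).2.2.2.1
    Q_φ := fun ε hε => (hdata ε hε).2.2.2.2.1
    ν_Q := fun ε hε => (hdata ε hε).2.2.2.2.2.1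
    summable := ?_
    normalised := fun ε hε => (hdata ε hε).2.2.2.2.2.2.1
    bounded := ⟨max c ‖S.φ₀‖, lt_max_of_lt_right S.norm_φ₀_pos,
      fun ε hε => (hdata ε hε).2.2.2.2.2.2.2.1⟩ }⟩⟩
  have hsum : Summable fun n : ℕ => C * ρ ^ n + C' * ρ' ^ n :=
    ((summable_geometric_of_lt_one hρ0.le hρ1).mul_left C).add
      ((summable_geometric_of_lt_one hρ0'.le hρ1').mul_left C')
  refine lt_of_le_of_lt (ENNReal.tsum_le_tsum fun n => iSup₂_le fun ε hε => ?_)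
    (lt_top_iff_ne_top.2 hsum.tsum_ofReal_ne_top)
  rw [← ofReal_norm]
  exact ENNReal.ofReal_le_ofReal ((hdata ε hε).2.2.2.2.2.2.2.2 n)

end REPFO

/-! ### The tails `κ_N` and the error `δ_ε`. -/

namespace REPFO.Decomposition

variable {M V E : Type*} [MetricSpace M] [MeasurableSpace M] [BorelSpace M]
  [NormedAddCommGroup V] [NormedSpace ℂ V] [TopologicalSpace E] [Zero E] {S : REPFO M V E}
  {U : Set E} (L : S.Decomposition U)

/-- `sup_{ε ∈ U} ‖Q_εⁿ‖` as a real number. -/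
noncomputable def supQ (n : ℕ) : ℝ := (⨆ ε ∈ U, ‖L.Q ε ^ n‖ₑ).toReal

theorem iSup_ne_top (n : ℕ) : ⨆ ε ∈ U, ‖L.Q ε ^ n‖ₑ ≠ ⊤ :=
  ENNReal.ne_top_of_tsum_ne_top L.summable.ne n

theorem supQ_nonneg (n : ℕ) : 0 ≤ L.supQ n := ENNReal.toReal_nonneg

theorem norm_Q_pow_le {ε : E} (hε : ε ∈ U) (n : ℕ) : ‖L.Q ε ^ n‖ ≤ L.supQ n := by
  rw [← toReal_enorm]
  exact ENNReal.toReal_mono (L.iSup_ne_top n)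
    (le_iSup₂ (f := fun ε (_ : ε ∈ U) => ‖L.Q ε ^ n‖ₑ) ε hε)

theorem summable_supQ : Summable L.supQ := ENNReal.summable_toReal L.summable.ne

theorem supQ_add_le (m n : ℕ) : L.supQ (m + n) ≤ L.supQ m * L.supQ n := by
  refine ENNReal.toReal_le_of_le_ofReal (mul_nonneg (L.supQ_nonneg m) (L.supQ_nonneg n))
    (iSup₂_le fun ε hε => ?_)
  rw [← ofReal_norm]
  refine ENNReal.ofReal_le_ofReal ((norm_pow_add_le _ m n).trans ?_)
  exact mul_le_mul (L.norm_Q_pow_le hε m) (L.norm_Q_pow_le hε n) (norm_nonneg _)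
    (L.supQ_nonneg m)

theorem κ_eq (N : ℕ) : L.κ N = ∑' k, L.supQ (N + k) :=
  ENNReal.tsum_toReal_eq fun _ => L.iSup_ne_top _

theorem κ_nonneg (N : ℕ) : 0 ≤ L.κ N := ENNReal.toReal_nonneg

theorem summable_supQ_add (N : ℕ) : Summable fun k => L.supQ (N + k) := by
  simpa only [add_comm N] using (summable_nat_add_iff N).2 L.summable_supQ

theorem norm_Q_pow_le_κ {ε : E} (hε : ε ∈ U) {N n : ℕ} (h : N ≤ n) :
    ‖L.Q ε ^ n‖ ≤ L.κ N := by
  obtain ⟨j, rfl⟩ := Nat.exists_eq_add_of_le h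
  rw [κ_eq]
  exact (L.norm_Q_pow_le hε _).trans
    ((L.summable_supQ_add N).le_tsum j fun _ _ => L.supQ_nonneg _)

/-- The suprema of `‖Q_ε^n‖` are submultiplicative in `n`, so their summability already forces
geometric decay. -/
theorem exists_κ_le_geometric :
    ∃ C > (0 : ℝ), ∃ ρ : ℝ, 0 < ρ ∧ ρ < 1 ∧ ∀ n, L.κ n ≤ C * ρ ^ n := by
  obtain ⟨C, hC, ρ, hρ0, hρ1, h⟩ := exists_geometric_bound_of_tendsto_zero L.supQ_nonneg
    L.supQ_add_le L.summable_supQ.tendsto_atTop_zero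
  have h1 : 0 < 1 - ρ := by linarith
  refine ⟨C * (1 - ρ)⁻¹, by positivity, ρ, hρ0, hρ1, fun n => ?_⟩
  rw [κ_eq]
  have hs : Summable fun k : ℕ => C * ρ ^ n * ρ ^ k :=
    (summable_geometric_of_lt_one hρ0.le hρ1).mul_left _
  calc _ ≤ ∑' k : ℕ, C * ρ ^ n * ρ ^ k := by
        refine (L.summable_supQ_add n).tsum_le_tsum (fun k => ?_) hs
        exact (h (n + k)).trans_eq (by rw [pow_add]; ring)
    _ = _ := by rw [tsum_mul_left, tsum_geometric_of_lt_one hρ0.le hρ1]; ring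

theorem tendsto_κ : Tendsto L.κ atTop (𝓝 0) := by
  obtain ⟨C, -, ρ, hρ0, hρ1, h⟩ := L.exists_κ_le_geometric
  have := (tendsto_pow_atTop_nhds_zero_of_lt_one hρ0.le hρ1).const_mul C
  rw [mul_zero] at this
  exact squeeze_zero L.κ_nonneg h this

theorem bddBelow_errors (ε : E) : BddBelow (L.errors ε) := by
  refine ⟨0, ?_⟩
  rintro _ ⟨N, -, rfl⟩
  have := S.η_nonneg ε
  have := L.κ_nonneg N
  positivity

theorem δ_le (ε : E) {N : ℕ} (hN : 1 ≤ N) : L.δ ε ≤ N * S.η ε + L.κ N :=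
  csInf_le (L.bddBelow_errors ε) ⟨N, hN, rfl⟩

theorem δ_nonneg (ε : E) : 0 ≤ L.δ ε := by
  refine le_csInf ⟨_, 1, le_rfl, rfl⟩ ?_
  rintro _ ⟨N, -, rfl⟩
  have := S.η_nonneg ε
  have := L.κ_nonneg N
  positivity

theorem η_le_δ (ε : E) : S.η ε ≤ L.δ ε := by
  refine le_csInf ⟨_, 1, le_rfl, rfl⟩ ?_
  rintro _ ⟨N, hN, rfl⟩
  have h1 := S.η_nonneg ε
  have h2 := L.κ_nonneg N
  have h3 : (1 : ℝ) ≤ N := by exact_mod_cast hN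
  nlinarith

/-- Positivity of `η_ε` makes `N η_ε + κ_N` tend to infinity with `N`. -/
theorem isLeast_δ {ε : E} (hε : 0 < S.η ε) : IsLeast (L.errors ε) (L.δ ε) := by
  have htend : Tendsto (fun n : ℕ => ((n + 1 : ℕ) : ℝ) * S.η ε + L.κ (n + 1)) cofinite atTop := by
    rw [Nat.cofinite_eq_atTop]
    refine tendsto_atTop_mono (fun n => le_add_of_nonneg_right (L.κ_nonneg _)) ?_
    exact ((tendsto_natCast_atTop_atTop (R := ℝ)).comp (tendsto_add_atTop_nat 1)).atTop_mul_const hε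
  obtain ⟨n, hn⟩ := htend.exists_forall_le
  have hleast : IsLeast (L.errors ε) (((n + 1 : ℕ) : ℝ) * S.η ε + L.κ (n + 1)) := by
    refine ⟨⟨n + 1, by omega, rfl⟩, ?_⟩
    rintro _ ⟨N, hN, rfl⟩
    obtain ⟨j, rfl⟩ := Nat.exists_eq_add_of_le' hN
    exact hn j
  rw [δ, hleast.csInf_eq]
  exact hleast

theorem tendsto_δ [CompleteSpace V] : Tendsto L.δ (𝓝[≠] 0) (𝓝 0) := by
  rw [Metric.tendsto_nhds]
  intro r hr
  obtain ⟨N, hN, hN1⟩ := ((L.tendsto_κ.eventually_lt_const (half_pos hr)).and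
    (eventually_ge_atTop 1)).exists
  have h1 : Tendsto (fun ε => (N : ℝ) * S.η ε) (𝓝[≠] 0) (𝓝 0) := by
    simpa using S.tendsto_η.const_mul (N : ℝ)
  filter_upwards [h1.eventually_lt_const (half_pos hr)] with ε hε
  rw [Real.dist_eq, sub_zero, abs_of_nonneg (L.δ_nonneg ε)]
  linarith [L.δ_le ε hN1]

theorem δ_isBigO [CompleteSpace V] (hη : ∀ᶠ ε in 𝓝[≠] (0 : E), 0 < S.η ε) :
    L.δ =O[𝓝[≠] 0] fun ε => S.η ε * Real.log (S.η ε) := by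
  obtain ⟨C, hC, ρ, hρ0, hρ1, h⟩ := L.exists_κ_le_geometric
  have hlogρ : Real.log ρ < 0 := Real.log_neg hρ0 hρ1
  refine Asymptotics.IsBigO.of_bound ((-Real.log ρ)⁻¹ + 1 + C) ?_
  filter_upwards [hη, S.tendsto_η.eventually_lt_const (Real.exp_pos (-1))] with ε hε hε1
  set x := S.η ε with hx
  have hlog : Real.log x < -1 := by
    rwa [← Real.log_exp (-1), Real.log_lt_log_iff hε (Real.exp_pos _)]
  -- The solution of `ρ ^ y = η_ε`; taking `N = ⌈y⌉₊` makes the geometric tail `O(η_ε)`. Since `η_ε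
  -- < e⁻¹`, additive constants are absorbed by `-log η_ε`.
  set y := Real.log x / Real.log ρ with hy
  have hypos : 0 < y := div_pos_of_neg_of_neg (by linarith) hlogρ
  have hN : 1 ≤ ⌈y⌉₊ := Nat.one_le_iff_ne_zero.2 (Nat.ceil_pos.2 hypos).ne'
  have hN2 : (⌈y⌉₊ : ℝ) ≤ y + 1 := (Nat.ceil_lt_add_one hypos.le).le
  have hpow : ρ ^ ⌈y⌉₊ ≤ x := by
    rw [← Real.rpow_natCast]
    calc ρ ^ ((⌈y⌉₊ : ℕ) : ℝ) ≤ ρ ^ y :=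
          Real.rpow_le_rpow_of_exponent_ge hρ0 hρ1.le (Nat.le_ceil y)
      _ = x := by
          rw [Real.rpow_def_of_pos hρ0, hy, mul_div_cancel₀ _ hlogρ.ne, Real.exp_log hε]
  have hyeq : y = (-Real.log ρ)⁻¹ * -Real.log x := by
    rw [hy]; field_simp
  rw [Real.norm_of_nonneg (L.δ_nonneg ε), norm_mul, Real.norm_of_nonneg hε.le,
    Real.norm_of_nonpos (by linarith)]
  calc L.δ ε ≤ ⌈y⌉₊ * x + L.κ ⌈y⌉₊ := L.δ_le ε hN
    _ ≤ (y + 1) * x + C * x := by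
      gcongr
      exact (h _).trans (by gcongr)
    _ ≤ ((-Real.log ρ)⁻¹ * -Real.log x + -Real.log x) * x + C * (x * -Real.log x) := by
      rw [hyeq]
      gcongr
      · linarith
      · nlinarith
    _ = _ := by ring

/-! ### Spectral identities at a fixed parameter. -/

variable {ε : E} (hε : ε ∈ U)
include hε

theorem P_pow {n : ℕ} (hn : 0 < n) :
    S.P ε ^ n = L.eigenvalue ε ^ n • ((L.ν ε).smulRight (L.φ ε) + L.Q ε ^ n) :=
  ContinuousLinearMap.pow_eq_of_rankOne_add (L.eigenvalue_ne ε hε) (L.decomp ε hε) (L.P_φ ε hε)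
    (L.ν_Q ε hε) hn

theorem ν_φ : L.ν ε (L.φ ε) = 1 := by
  have h := congrArg (fun l : V →L[ℂ] V => l (L.φ ε)) (L.decomp ε hε)
  simp only [_root_.smul_apply, _root_.add_apply, ContinuousLinearMap.smulRight_apply,
    L.P_φ ε hε, L.Q_φ ε hε, add_zero, inv_smul_smul₀ (L.eigenvalue_ne ε hε)] at h
  have h2 := congrArg S.ν₀ h
  rw [map_smul, L.normalised ε hε, smul_eq_mul, mul_one] at h2
  exact h2.symm

theorem one_sub_eigenvalue : 1 - L.eigenvalue ε = S.ν₀ ((S.P 0 - S.P ε) (L.φ ε)) := by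
  rw [_root_.sub_apply, map_sub, S.ν₀_P_zero, L.P_φ ε hε, map_smul, L.normalised ε hε]
  simp

theorem norm_eigenvalue_sub_one_le {c : ℝ} (hc : ∀ ε ∈ U, ‖L.φ ε‖ ≤ c) :
    ‖L.eigenvalue ε - 1‖ ≤ c * S.η ε := by
  rw [norm_sub_rev, L.one_sub_eigenvalue hε, mul_comm]
  exact (S.norm_ν₀_P_zero_sub_P_le ε _).trans
    (mul_le_mul_of_nonneg_left (hc ε hε) (S.η_nonneg ε))

theorem ν₀_P_pow_φ₀_eq {n : ℕ} (hn : 0 < n) : S.ν₀ ((S.P ε ^ n) S.φ₀) =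
    L.eigenvalue ε ^ n * (L.ν ε S.φ₀ + S.ν₀ ((L.Q ε ^ n) S.φ₀)) := by
  rw [L.P_pow hε hn]
  simp only [_root_.smul_apply, _root_.add_apply, ContinuousLinearMap.smulRight_apply, map_smul,
    map_add, L.normalised ε hε, smul_eq_mul, mul_one]

theorem Q_pow_φ {n : ℕ} (hn : 0 < n) : (L.Q ε ^ n) (L.φ ε) = 0 := by
  obtain ⟨m, rfl⟩ := Nat.exists_eq_add_of_le' hn
  rw [pow_succ, mul_apply_eq_comp, L.Q_φ ε hε, map_zero]

/-- The component of `φ₀` in the kernel of `ν_ε` is controlled by `(P₀ - P_ε) φ₀`. -/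
theorem norm_φ₀_sub_le {m : ℕ} (hm : 0 < m) (hl : 1 / 2 ≤ ‖L.eigenvalue ε‖)
    (hlm : ‖L.eigenvalue ε‖ ^ m * L.supQ m ≤ 1 / 2) :
    ‖S.φ₀ - L.ν ε S.φ₀ • L.φ ε‖ ≤
      2 * (m * (2 * S.D * (1 + 4 * S.D + L.supQ 1))) * ‖(S.P 0 - S.P ε) S.φ₀‖ := by
  have hD := S.D_pos
  have hl0 := L.eigenvalue_ne ε hε
  set R := (S.P 0 - S.P ε) S.φ₀ with hR
  set ψ := S.φ₀ - L.ν ε S.φ₀ • L.φ ε with hψ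
  set r := R - L.ν ε R • L.φ ε with hr
  have hνP : ∀ f, L.ν ε (S.P ε f) = L.eigenvalue ε * L.ν ε f := fun f =>
    congrArg (fun l : V →L[ℂ] ℂ => l f) (L.ν_P ε hε)
  have hψr : ψ - S.P ε ψ = r := by
    simp only [hψ, hr, hR, _root_.sub_apply, S.P_φ₀, map_sub, map_smul, L.P_φ ε hε, hνP]
    module
  have hνψ : L.ν ε ψ = 0 := by simp [hψ, L.ν_φ hε]
  have hrn : ‖r‖ ≤ (1 + 4 * S.D + L.supQ 1) * ‖R‖ := by
    -- Writing the projection along `φ_ε` as `1 - λ_ε⁻¹ P_ε + Q_ε` gives a uniform bound without any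
    -- bound on `‖ν_ε‖`.
    have h1 : r = R - (L.eigenvalue ε)⁻¹ • S.P ε R + L.Q ε R := by
      have h := congrArg (fun l : V →L[ℂ] V => l R) (L.decomp ε hε)
      simp only [_root_.smul_apply, _root_.add_apply, ContinuousLinearMap.smulRight_apply] at h
      rw [h, hr]; abel
    have h2 : ‖(L.eigenvalue ε)⁻¹ • S.P ε R‖ ≤ 2 * (2 * S.D * ‖R‖) := by
      rw [norm_smul, norm_inv]
      have h3 : ‖L.eigenvalue ε‖⁻¹ ≤ 2 := by
        rw [inv_le_comm₀ (by linarith) (by norm_num)]; linarith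
      gcongr
      exact (S.P ε).le_of_opNorm_le (by simpa using S.norm_P_pow_le ε 1) R
    have h4 : ‖L.Q ε R‖ ≤ L.supQ 1 * ‖R‖ :=
      (L.Q ε).le_of_opNorm_le (by simpa using L.norm_Q_pow_le hε 1) R
    rw [h1]
    refine (norm_add_le_of_le (norm_sub_le_of_le le_rfl h2) h4).trans_eq ?_
    ring
  have htel : ∀ n : ℕ, ‖ψ - (S.P ε ^ n) ψ‖ ≤ n * (2 * S.D * ‖r‖) := fun n => by
    induction n with
    | zero => simp
    | succ n ih =>
      have h1 : ψ - (S.P ε ^ (n + 1)) ψ = (ψ - (S.P ε ^ n) ψ) + (S.P ε ^ n) r := by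
        have h2 : (S.P ε ^ n) r = (S.P ε ^ n) ψ - (S.P ε ^ (n + 1)) ψ := by
          rw [← hψr, pow_succ]; exact map_sub _ _ _
        rw [h2, sub_add_sub_cancel]
      rw [h1]
      refine (norm_add_le_of_le ih
        ((S.P ε ^ n).le_of_opNorm_le (S.norm_P_pow_le ε n) r)).trans_eq ?_
      push_cast; ring
  -- On the kernel of `ν_ε` the power `P_ε^m` acts as `λ_ε^m Q_ε^m` and halves norms, so `ψ` is
  -- controlled by the telescoped difference `ψ - P_ε^m ψ`.
  have hPm : ‖(S.P ε ^ m) ψ‖ ≤ 1 / 2 * ‖ψ‖ := by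
    rw [L.P_pow hε hm]
    simp only [_root_.smul_apply, _root_.add_apply, ContinuousLinearMap.smulRight_apply, hνψ,
      zero_smul, zero_add]
    rw [norm_smul, norm_pow]
    calc _ ≤ ‖L.eigenvalue ε‖ ^ m * (L.supQ m * ‖ψ‖) := by
          gcongr
          exact (L.Q ε ^ m).le_of_opNorm_le (L.norm_Q_pow_le hε m) ψ
      _ = (‖L.eigenvalue ε‖ ^ m * L.supQ m) * ‖ψ‖ := by ring
      _ ≤ _ := by gcongr
  have h5 : ‖ψ‖ ≤ m * (2 * S.D * ‖r‖) + 1 / 2 * ‖ψ‖ := by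
    calc ‖ψ‖ = ‖(ψ - (S.P ε ^ m) ψ) + (S.P ε ^ m) ψ‖ := by rw [sub_add_cancel]
      _ ≤ _ := norm_add_le_of_le (htel m) hPm
  calc ‖ψ‖ ≤ 2 * (m * (2 * S.D * ‖r‖)) := by linarith
    _ ≤ 2 * (m * (2 * S.D * ((1 + 4 * S.D + L.supQ 1) * ‖R‖))) := by gcongr
    _ = _ := by ring

/-- Two evaluations of `ν₀((P₀ - P_ε) P_ε^n φ₀)`: by telescoping and by the spectral decomposition.
-/
theorem ν_φ₀_mul_one_sub_eigenvalue (hΔ : S.Δ ε ≠ 0) {n : ℕ} (hn : 0 < n) :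
    (1 - L.eigenvalue ε) / S.Δ ε * L.ν ε S.φ₀ =
      (L.eigenvalue ε ^ n)⁻¹ * (1 - ∑ k ∈ Finset.range n, S.q k ε) -
        S.ν₀ ((S.P 0 - S.P ε) ((L.Q ε ^ n) S.φ₀)) / S.Δ ε := by
  have hl0 := pow_ne_zero n (L.eigenvalue_ne ε hε)
  have h1 := S.ν₀_sub_P_pow_φ₀ hΔ n
  rw [L.P_pow hε hn] at h1
  simp only [_root_.smul_apply, _root_.add_apply, ContinuousLinearMap.smulRight_apply, map_smul,
    map_add, ← L.one_sub_eigenvalue hε, smul_eq_mul] at h1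
  have h2 : 1 - ∑ k ∈ Finset.range n, S.q k ε = L.eigenvalue ε ^ n * (L.ν ε S.φ₀ *
      (1 - L.eigenvalue ε) + S.ν₀ ((S.P 0 - S.P ε) ((L.Q ε ^ n) S.φ₀))) / S.Δ ε := by
    rw [h1, mul_div_cancel_left₀ _ hΔ]
  rw [h2]
  field_simp
  ring

end REPFO.Decomposition

/-! ### Asymptotics of the leading eigenvalue. -/

namespace REPFO.Decomposition

variable {M V E : Type*} [MetricSpace M] [MeasurableSpace M] [BorelSpace M]
  [NormedAddCommGroup V] [NormedSpace ℂ V] [CompleteSpace V] [TopologicalSpace E] [Zero E]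
  {S : REPFO M V E} {U : Set E} (L : S.Decomposition U)

theorem tendsto_eigenvalue (hU : U ∈ 𝓝 (0 : E)) :
    Tendsto L.eigenvalue (𝓝[≠] 0) (𝓝 1) := by
  obtain ⟨c, -, hc⟩ := L.bounded
  rw [tendsto_iff_norm_sub_tendsto_zero]
  have h : Tendsto (fun ε => c * S.η ε) (𝓝[≠] 0) (𝓝 0) := by
    simpa using S.tendsto_η.const_mul c
  refine squeeze_zero' (Eventually.of_forall fun _ => norm_nonneg _) ?_ h
  filter_upwards [nhdsWithin_le_nhds hU] with ε hε
  exact L.norm_eigenvalue_sub_one_le hε hc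

/-- Comparison of the survival probabilities with powers of the leading eigenvalue, uniformly in
the time. -/
theorem exists_norm_ν₀_P_pow_φ₀_sub_le (hU : U ∈ 𝓝 (0 : E))
    (hη : ∀ᶠ ε in 𝓝[≠] (0 : E), 0 < S.η ε) :
    ∃ C : ℝ, 0 ≤ C ∧ ∀ᶠ ε in 𝓝[≠] (0 : E), ‖L.ν ε S.φ₀ - 1‖ ≤ C * L.δ ε ∧
      ∀ n, ‖S.ν₀ ((S.P ε ^ n) S.φ₀) - L.eigenvalue ε ^ n‖ ≤
        C * L.δ ε * ‖L.eigenvalue ε‖ ^ n := by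
  obtain ⟨c, hc0, hc⟩ := L.bounded
  have hD := S.D_pos
  set K : ℝ := 2 * S.D * ‖S.φ₀‖ + 2 * c with hK
  have hK0 : 0 ≤ K := by positivity
  have hν : 0 ≤ ‖S.ν₀‖ * ‖S.φ₀‖ := by positivity
  refine ⟨2 * K + 2 * (‖S.ν₀‖ * ‖S.φ₀‖), by positivity, ?_⟩
  have hcδ : Tendsto (fun ε => c * L.δ ε) (𝓝[≠] 0) (𝓝 0) := by
    simpa using L.tendsto_δ.const_mul c
  filter_upwards [nhdsWithin_le_nhds hU, hη,
    hcδ.eventually_lt_const (by norm_num : (0 : ℝ) < 1 / 4)] with ε hε hηε hδ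
  have hl0 := L.eigenvalue_ne ε hε
  set l := L.eigenvalue ε with hl
  have hln : ∀ n : ℕ, 0 < ‖l‖ ^ n := fun n => pow_pos (norm_pos_iff.2 hl0) n
  have hδ0 := L.δ_nonneg ε
  have hη0 := S.η_nonneg ε
  obtain ⟨N, hN, hNδ⟩ := (L.isLeast_δ hηε).1
  have hκ0 := L.κ_nonneg N
  have hNη0 : 0 ≤ N * S.η ε := by positivity
  have hshort : ∀ n ≤ N, ‖S.ν₀ ((S.P ε ^ n) S.φ₀) - l ^ n‖ ≤ 2 * K * L.δ ε * ‖l‖ ^ n := by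
    intro n hn
    have hnN : (n : ℝ) * S.η ε ≤ N * S.η ε := by gcongr
    have hnη : n * S.η ε ≤ L.δ ε := by linarith
    have hnc : (n : ℝ) * (c * S.η ε) ≤ 1 / 4 := by
      calc (n : ℝ) * (c * S.η ε) = c * (n * S.η ε) := by ring
        _ ≤ c * L.δ ε := by gcongr
        _ ≤ _ := hδ.le
    have h1 := norm_pow_sub_one_le_of_norm_sub_one_le (L.norm_eigenvalue_sub_one_le hε hc)
      (hnc.trans (by norm_num))
    have h2 := S.norm_ν₀_P_pow_φ₀_sub_one_le ε n
    have h3 : 1 / 2 ≤ ‖l‖ ^ n := by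
      have := norm_sub_norm_le 1 (l ^ n)
      rw [norm_one, norm_sub_rev, norm_pow] at this
      linarith
    calc ‖S.ν₀ ((S.P ε ^ n) S.φ₀) - l ^ n‖
        = ‖(S.ν₀ ((S.P ε ^ n) S.φ₀) - 1) - (l ^ n - 1)‖ := by congr 1; ring
      _ ≤ 2 * S.D * ‖S.φ₀‖ * (n * S.η ε) + 2 * (n * (c * S.η ε)) := norm_sub_le_of_le h2 h1
      _ = K * (n * S.η ε) := by rw [hK]; ring
      _ ≤ K * L.δ ε := by gcongr
      _ = 2 * K * L.δ ε * (1 / 2) := by ring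
      _ ≤ _ := by gcongr
  have hfac : ∀ n, 0 < n → S.ν₀ ((S.P ε ^ n) S.φ₀) - l ^ n =
      l ^ n * (L.ν ε S.φ₀ + S.ν₀ ((L.Q ε ^ n) S.φ₀) - 1) := fun n hn => by
    rw [L.ν₀_P_pow_φ₀_eq hε hn]; ring
  have hQ : ∀ n, N ≤ n → ‖S.ν₀ ((L.Q ε ^ n) S.φ₀)‖ ≤ ‖S.ν₀‖ * ‖S.φ₀‖ * L.δ ε := by
    intro n hn
    calc _ ≤ ‖S.ν₀‖ * (L.κ N * ‖S.φ₀‖) := by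
          refine (S.ν₀.le_opNorm _).trans ?_
          gcongr
          exact (L.Q ε ^ n).le_of_opNorm_le (L.norm_Q_pow_le_κ hε hn) _
      _ ≤ ‖S.ν₀‖ * (L.δ ε * ‖S.φ₀‖) := by gcongr; linarith
      _ = _ := by ring
  have hN0 : 0 < N := hN
  -- The time `N` belongs to both regimes: dividing the short time estimate by `λ_ε^N` yields the
  -- estimate of `ν_ε(φ₀)` needed for long times.
  have hνN : ‖L.ν ε S.φ₀ + S.ν₀ ((L.Q ε ^ N) S.φ₀) - 1‖ ≤ 2 * K * L.δ ε := by
    have h1 := hshort N le_rfl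
    rw [hfac N hN0, norm_mul, norm_pow, mul_comm] at h1
    exact le_of_mul_le_mul_right h1 (hln N)
  have hν1 : ‖L.ν ε S.φ₀ - 1‖ ≤ (2 * K + ‖S.ν₀‖ * ‖S.φ₀‖) * L.δ ε := by
    calc ‖L.ν ε S.φ₀ - 1‖ = ‖(L.ν ε S.φ₀ + S.ν₀ ((L.Q ε ^ N) S.φ₀) - 1)
          - S.ν₀ ((L.Q ε ^ N) S.φ₀)‖ := by congr 1; ring
      _ ≤ _ := norm_sub_le_of_le hνN (hQ N le_rfl)
      _ = _ := by ring
  refine ⟨hν1.trans (mul_le_mul_of_nonneg_right (by linarith) hδ0), fun n => ?_⟩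
  rcases le_total n N with hn | hn
  · exact (hshort n hn).trans (by gcongr; linarith)
  · rw [hfac n (hN0.trans_le hn), norm_mul, norm_pow, mul_comm]
    gcongr
    calc _ = ‖(L.ν ε S.φ₀ - 1) + S.ν₀ ((L.Q ε ^ n) S.φ₀)‖ := by congr 1; ring
      _ ≤ _ := norm_add_le_of_le hν1 (hQ n hn)
      _ = _ := by ring

theorem tendsto_ν_φ₀ (hU : U ∈ 𝓝 (0 : E)) (hη : ∀ᶠ ε in 𝓝[≠] (0 : E), 0 < S.η ε) :
    Tendsto (fun ε => L.ν ε S.φ₀) (𝓝[≠] 0) (𝓝 1) := by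
  obtain ⟨C, -, hC⟩ := L.exists_norm_ν₀_P_pow_φ₀_sub_le hU hη
  rw [tendsto_iff_norm_sub_tendsto_zero]
  have h : Tendsto (fun ε => C * L.δ ε) (𝓝[≠] 0) (𝓝 0) := by
    simpa using L.tendsto_δ.const_mul C
  exact squeeze_zero' (Eventually.of_forall fun _ => norm_nonneg _) (hC.mono fun _ h => h.1) h

/-- The remainder `Q_εⁿ φ₀` is negligible against the mass of the hole. -/
theorem exists_η_mul_norm_Q_pow_φ₀_le (hU : U ∈ 𝓝 (0 : E)) :
    ∃ C : ℝ, 0 ≤ C ∧ ∀ᶠ ε in 𝓝[≠] (0 : E), ∀ n > 0,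
      S.η ε * ‖(L.Q ε ^ n) S.φ₀‖ ≤ C * L.supQ n * ‖S.Δ ε‖ := by
  have hD := S.D_pos
  obtain ⟨K, hK0, hK⟩ := S.exists_η_mul_norm_le
  obtain ⟨m, hm, hm0⟩ := ((L.summable_supQ.tendsto_atTop_zero.eventually_lt_const
    (by norm_num : (0 : ℝ) < 1 / 4)).and (eventually_gt_atTop 0)).exists
  have hQ1 := L.supQ_nonneg 1
  set A : ℝ := 2 * (m * (2 * S.D * (1 + 4 * S.D + L.supQ 1))) with hA
  have hA0 : 0 ≤ A := by positivity
  refine ⟨A * K, by positivity, ?_⟩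
  have hl := (L.tendsto_eigenvalue hU).norm
  rw [norm_one] at hl
  have hlm := hl.pow m
  rw [one_pow] at hlm
  filter_upwards [nhdsWithin_le_nhds hU, hl.eventually_const_lt (by norm_num : (1 / 2 : ℝ) < 1),
    hlm.eventually_lt_const (by norm_num : (1 : ℝ) < 2)] with ε hε h1 h2 n hn
  have hQm := L.supQ_nonneg m
  have hψ := L.norm_φ₀_sub_le hε hm0 h1.le (by nlinarith)
  have hQn := L.supQ_nonneg n
  -- `Q_ε^n` kills `φ_ε`, so only the component of `φ₀` in the kernel of `ν_ε` matters.
  have h3 : (L.Q ε ^ n) S.φ₀ = (L.Q ε ^ n) (S.φ₀ - L.ν ε S.φ₀ • L.φ ε) := by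
    rw [map_sub, map_smul, L.Q_pow_φ hε hn, smul_zero, sub_zero]
  calc S.η ε * ‖(L.Q ε ^ n) S.φ₀‖
      ≤ S.η ε * (L.supQ n * (A * ‖(S.P 0 - S.P ε) S.φ₀‖)) := by
        refine mul_le_mul_of_nonneg_left ?_ (S.η_nonneg ε)
        rw [h3]
        exact ((L.Q ε ^ n).le_of_opNorm_le (L.norm_Q_pow_le hε n) _).trans (by gcongr)
    _ = A * L.supQ n * (S.η ε * ‖(S.P 0 - S.P ε) S.φ₀‖) := by ring
    _ ≤ A * L.supQ n * (K * ‖S.Δ ε‖) :=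
        mul_le_mul_of_nonneg_left (hK ε) (by positivity)
    _ = _ := by ring

/-- The first order expansion of the leading eigenvalue. -/
theorem tendsto_one_sub_eigenvalue_div (hU : U ∈ 𝓝 (0 : E))
    (hη : ∀ᶠ ε in 𝓝[≠] (0 : E), 0 < S.η ε) (hΔ : ∀ᶠ ε in 𝓝[≠] (0 : E), S.Δ ε ≠ 0)
    {q : ℕ → ℝ} (hq : ∀ k, Tendsto (S.q k) (𝓝[≠] 0) (𝓝 (q k : ℂ))) :
    Tendsto (fun ε => (1 - L.eigenvalue ε) / S.Δ ε) (𝓝[≠] 0) (𝓝 ((1 - ∑' k, q k : ℝ) : ℂ)) := by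
  -- If 0 is isolated the limits carry no information about `q`; otherwise positivity passes to the
  -- limit and makes `q` summable.
  rcases eq_or_neBot (𝓝[≠] (0 : E)) with hbot | hne
  · rw [hbot]; exact tendsto_bot
  have hsum : ∀ n, Tendsto (fun ε => 1 - ∑ k ∈ Finset.range n, S.q k ε) (𝓝[≠] 0)
      (𝓝 ((1 - ∑ k ∈ Finset.range n, q k : ℝ) : ℂ)) := fun n => by
    push_cast
    exact (tendsto_finsetSum _ fun k _ => hq k).const_sub 1
  have hq0 : ∀ k, 0 ≤ q k := fun k => by
    refine ge_of_tendsto (Complex.continuous_re.tendsto _ |>.comp (hq k))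
      (Eventually.of_forall fun ε => ?_)
    obtain ⟨r, hr, h⟩ := S.exists_nonneg_q k ε
    simpa [h] using hr
  have hq1 : ∀ n, ∑ k ∈ Finset.range n, q k ≤ 1 := fun n => by
    have h1 : (0 : ℝ) ≤ 1 - ∑ k ∈ Finset.range n, q k := by
      refine ge_of_tendsto (Complex.continuous_re.tendsto _ |>.comp (hsum n)) ?_
      filter_upwards [hΔ] with ε hε
      obtain ⟨r, hr, h⟩ := S.exists_nonneg_one_sub_sum_q hε n
      simp only [Function.comp_apply, h]
      simpa using hr
    linarith
  have hqsum : Summable q := summable_of_sum_range_le hq0 hq1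
  set θ : ℝ := 1 - ∑' k, q k with hθ
  obtain ⟨C, hC0, hC⟩ := L.exists_η_mul_norm_Q_pow_φ₀_le hU
  have hv := L.tendsto_ν_φ₀ hU hη
  have hprod : Tendsto (fun ε => (1 - L.eigenvalue ε) / S.Δ ε * L.ν ε S.φ₀) (𝓝[≠] 0)
      (𝓝 (θ : ℂ)) := by
    rw [Metric.tendsto_nhds]
    intro r hr
    have hr3 : 0 < r / 3 := by positivity
    have h1 : Tendsto (fun n => C * L.supQ n) atTop (𝓝 0) := by
      simpa using L.summable_supQ.tendsto_atTop_zero.const_mul C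
    have h2 : Tendsto (fun n => 1 - ∑ k ∈ Finset.range n, q k) atTop (𝓝 θ) :=
      hqsum.hasSum.tendsto_sum_nat.const_sub 1
    -- First `n` is fixed so that the remainder and the tail of `∑ q k` are small; then `ε → 0`.
    obtain ⟨n, ⟨hn1, hn2⟩, hn0⟩ := ((h1.eventually_lt_const hr3).and
      ((Metric.tendsto_nhds.1 h2 _ hr3))).and (eventually_gt_atTop 0) |>.exists
    have h3 : Tendsto (fun ε => (L.eigenvalue ε ^ n)⁻¹ *
        (1 - ∑ k ∈ Finset.range n, S.q k ε)) (𝓝[≠] 0)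
        (𝓝 ((1 - ∑ k ∈ Finset.range n, q k : ℝ) : ℂ)) := by
      have h4 := (((L.tendsto_eigenvalue hU).pow n).inv₀ (by simp)).mul (hsum n)
      simpa using h4
    filter_upwards [nhdsWithin_le_nhds hU, hΔ, hC, Metric.tendsto_nhds.1 h3 _ hr3]
      with ε hε hΔε hCε h5
    have h6 : ‖S.ν₀ ((S.P 0 - S.P ε) ((L.Q ε ^ n) S.φ₀)) / S.Δ ε‖ ≤ C * L.supQ n := by
      rw [norm_div, div_le_iff₀ (norm_pos_iff.2 hΔε)]
      exact (S.norm_ν₀_P_zero_sub_P_le ε _).trans (hCε n hn0)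
    rw [dist_eq_norm] at h5 hn2 ⊢
    have h7 : ‖((1 - ∑ k ∈ Finset.range n, q k : ℝ) : ℂ) - (θ : ℂ)‖ < r / 3 := by
      rw [← Complex.ofReal_sub, Complex.norm_real]; exact hn2
    rw [L.ν_φ₀_mul_one_sub_eigenvalue hε hΔε hn0]
    calc _ = ‖((L.eigenvalue ε ^ n)⁻¹ * (1 - ∑ k ∈ Finset.range n, S.q k ε)
            - ((1 - ∑ k ∈ Finset.range n, q k : ℝ) : ℂ))
          + (((1 - ∑ k ∈ Finset.range n, q k : ℝ) : ℂ) - (θ : ℂ))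
          - S.ν₀ ((S.P 0 - S.P ε) ((L.Q ε ^ n) S.φ₀)) / S.Δ ε‖ := by congr 1; ring
      _ ≤ _ := (norm_sub_le _ _).trans (add_le_add (norm_add_le _ _) h6)
      _ < r := by linarith
  have hdiv := hprod.div hv one_ne_zero
  rw [div_one] at hdiv
  refine hdiv.congr' ?_
  filter_upwards [hv.eventually_ne one_ne_zero] with ε hε
  simp only [Pi.div_apply]
  exact mul_div_cancel_right₀ _ hε

/-- With `z = λ_ε - 1`, `log|λ_ε|` differs from `Re z` by at most `|z|²`, and `|z|² / μ₀(A_ε)` is a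
null factor `|z|` times a convergent one. -/
theorem tendsto_neg_log_eigenvalue_div (hU : U ∈ 𝓝 (0 : E))
    (hη : ∀ᶠ ε in 𝓝[≠] (0 : E), 0 < S.η ε)
    (hμ : ∀ᶠ ε in 𝓝[≠] (0 : E), 0 < S.μ₀.real (S.A ε))
    {q : ℕ → ℝ} (hq : ∀ k, Tendsto (S.q k) (𝓝[≠] 0) (𝓝 (q k : ℂ))) :
    Tendsto (fun ε => -Real.log ‖L.eigenvalue ε‖ / S.μ₀.real (S.A ε)) (𝓝[≠] 0)
      (𝓝 (1 - ∑' k, q k)) := by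
  have hΔ : ∀ᶠ ε in 𝓝[≠] (0 : E), S.Δ ε ≠ 0 := hμ.mono fun ε h => by
    rw [S.Δ_eq]; exact_mod_cast h.ne'
  have hw := L.tendsto_one_sub_eigenvalue_div hU hη hΔ hq
  have hl := L.tendsto_eigenvalue hU
  have hl1 : Tendsto (fun ε => ‖L.eigenvalue ε - 1‖) (𝓝[≠] 0) (𝓝 0) :=
    tendsto_iff_norm_sub_tendsto_zero.1 hl
  have hre : Tendsto (fun ε => ((1 - L.eigenvalue ε) / S.Δ ε).re) (𝓝[≠] 0)
      (𝓝 (1 - ∑' k, q k)) := (Complex.continuous_re.tendsto _).comp hw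
  have herr : Tendsto (fun ε => ‖L.eigenvalue ε - 1‖ * ‖(1 - L.eigenvalue ε) / S.Δ ε‖) (𝓝[≠] 0)
      (𝓝 0) := by
    simpa using hl1.mul hw.norm
  refine tendsto_of_tendsto_of_dist hre (squeeze_zero' (Eventually.of_forall fun _ =>
    dist_nonneg) ?_ herr)
  filter_upwards [hμ, hl1.eventually_lt_const (by norm_num : (0 : ℝ) < 1 / 2)] with ε hμε hlε
  set m := S.μ₀.real (S.A ε) with hm
  set z := L.eigenvalue ε - 1 with hz
  have h1 := Complex.norm_log_one_add_sub_self_le (z := z) (by linarith)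
  have h2 : ‖Complex.log (1 + z) - z‖ ≤ ‖z‖ ^ 2 := by
    have h3 : (1 - ‖z‖)⁻¹ ≤ 2 := by
      rw [inv_le_comm₀ (by linarith) (by norm_num)]; linarith
    nlinarith [sq_nonneg ‖z‖]
  have h4 : |Real.log ‖L.eigenvalue ε‖ - z.re| ≤ ‖z‖ ^ 2 := by
    have h5 : (Complex.log (1 + z) - z).re = Real.log ‖L.eigenvalue ε‖ - z.re := by
      rw [Complex.sub_re, Complex.log_re, hz, add_sub_cancel]
    rw [← h5]
    exact (Complex.abs_re_le_norm _).trans h2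
  have h6 : 1 - L.eigenvalue ε = -z := by rw [hz]; ring
  have h7 : ((1 - L.eigenvalue ε) / S.Δ ε).re = -z.re / m := by
    rw [h6, S.Δ_eq, Complex.div_ofReal_re, Complex.neg_re]
  have h8 : ‖(1 - L.eigenvalue ε) / S.Δ ε‖ = ‖z‖ / m := by
    rw [h6, S.Δ_eq, norm_div, norm_neg, Complex.norm_real, Real.norm_of_nonneg hμε.le]
  rw [h7, h8, Real.dist_eq, ← sub_div, abs_div, abs_of_pos hμε, ← mul_div_assoc]
  refine div_le_div_of_nonneg_right ?_ hμε.le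
  calc _ = |Real.log ‖L.eigenvalue ε‖ - z.re| := by congr 1; ring
    _ ≤ _ := h4.trans_eq (sq _)

end REPFO.Decomposition

/-! ### The exponential law. -/

theorem mainTheorem2 {M V E : Type*} [MetricSpace M] [MeasurableSpace M] [BorelSpace M]
    [NormedAddCommGroup V] [NormedSpace ℂ V] [CompleteSpace V]
    [TopologicalSpace E] [Zero E] (S : REPFO M V E)
    (hA : ∀ ε : E, ε ≠ 0 → 0 < S.μ₀ (S.A ε))
    (q : ℕ → ℝ) (hq : ∀ k, Tendsto (S.q k) (𝓝[≠] 0) (𝓝 (q k : ℂ)))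
    (θ : ℝ) (hθ : θ = 1 - ∑' k, q k) (hθ_pos : 0 < θ) :
    (∃ U ∈ 𝓝 (0 : E), Nonempty (S.Decomposition U)) ∧
    ∀ U ∈ 𝓝 (0 : E), ∀ L : S.Decomposition U,
      (∃ C > (0 : ℝ), ∃ ξ : E → ℝ, Tendsto ξ (𝓝[≠] 0) (𝓝 θ) ∧
        ∀ᶠ ε in 𝓝[≠] (0 : E), 0 < ξ ε ∧ ∀ t > (0 : ℝ),
          |S.μ₀.real {x | ((t / (ξ ε * S.μ₀.real (S.A ε)) : ℝ) : EReal) ≤ S.τ ε x}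
              - Real.exp (-t)|
            ≤ C * L.δ ε * max t 1 * Real.exp (-t)) ∧
      (∀ ε : E, ε ≠ 0 → IsLeast (L.errors ε) (L.δ ε)) ∧
      L.δ =O[𝓝[≠] 0] fun ε => S.η ε * Real.log (S.η ε) := by
  have := S.probability_μ₀
  have hμ : ∀ ε : E, ε ≠ 0 → 0 < S.μ₀.real (S.A ε) := fun ε hε =>
    ENNReal.toReal_pos (hA ε hε).ne' (measure_ne_top _ _)
  have hμη : ∀ ε, S.μ₀.real (S.A ε) ≤ S.η ε * ‖S.φ₀‖ := fun ε => by
    have h := S.norm_ν₀_P_zero_sub_P_le ε S.φ₀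
    have h1 : S.ν₀ ((S.P 0 - S.P ε) S.φ₀) = S.μ₀.real (S.A ε) := S.Δ_eq ε
    rwa [h1, Complex.norm_real, Real.norm_of_nonneg measureReal_nonneg] at h
  have hη : ∀ ε : E, ε ≠ 0 → 0 < S.η ε := fun ε hε =>
    pos_of_mul_pos_left ((hμ ε hε).trans_le (hμη ε)) (norm_nonneg _)
  have hη' : ∀ᶠ ε in 𝓝[≠] (0 : E), 0 < S.η ε := eventually_mem_nhdsWithin.mono hη
  have hμ' : ∀ᶠ ε in 𝓝[≠] (0 : E), 0 < S.μ₀.real (S.A ε) := eventually_mem_nhdsWithin.mono hμ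
  refine ⟨S.exists_decomposition, fun U hU L => ⟨?_, fun ε hε => L.isLeast_δ (hη ε hε),
    L.δ_isBigO hη'⟩⟩
  obtain ⟨C, hC0, hC⟩ := L.exists_norm_ν₀_P_pow_φ₀_sub_le hU hη'
  have hξ := L.tendsto_neg_log_eigenvalue_div hU hη' hμ' hq
  rw [← hθ] at hξ
  have hφ := S.norm_φ₀_pos
  -- `C` comes from the comparison with `λ_ε^n`; the other term bounds the rounding error `p = ξ_ε
  -- μ₀(A_ε)`, using `ξ_ε < θ + 1` and `μ₀(A_ε) ≤ η_ε ‖φ₀‖`.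
  refine ⟨C + (θ + 1) * ‖S.φ₀‖, by positivity, _, hξ, ?_⟩
  filter_upwards [nhdsWithin_le_nhds hU, hμ', hC, hξ.eventually_const_lt hθ_pos,
    hξ.eventually_lt_const (lt_add_one θ)] with ε hε hμε hCε hξ0 hξ1
  refine ⟨hξ0, fun t ht => ?_⟩
  have hδ0 := L.δ_nonneg ε
  set m := S.μ₀.real (S.A ε) with hm
  set p := -Real.log ‖L.eigenvalue ε‖ with hp
  have hpm : p / m * m = p := div_mul_cancel₀ _ hμε.ne'
  have hp0 : 0 < p := by rw [← hpm]; positivity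
  have hpδ : p ≤ (θ + 1) * ‖S.φ₀‖ * L.δ ε := by
    calc p = p / m * m := hpm.symm
      _ ≤ (θ + 1) * (S.η ε * ‖S.φ₀‖) := by gcongr; exact hμη ε
      _ ≤ (θ + 1) * (L.δ ε * ‖S.φ₀‖) := by gcongr; exact L.η_le_δ ε
      _ = _ := by ring
  rw [hpm]
  set n := ⌈t / p⌉₊ with hn
  have hset : {x | ((t / p : ℝ) : EReal) ≤ S.τ ε x} = {x | ∀ i < n, S.T^[i] x ∉ S.A ε} :=
    Set.ext fun x => S.τ_ge_iff ε _ x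
  rw [hset]
  set a := S.μ₀.real {x | ∀ i < n, S.T^[i] x ∉ S.A ε} with ha
  have hln : ‖L.eigenvalue ε‖ ^ n = Real.exp (-(n * p)) := by
    rw [hp, mul_neg, neg_neg, Real.exp_nat_mul,
      Real.exp_log (norm_pos_iff.2 (L.eigenvalue_ne ε hε))]
  -- The eigenvalue may be complex; since `a` is nonnegative, passing to moduli loses nothing.
  have h1 : |a - Real.exp (-(n * p))| ≤ C * L.δ ε * Real.exp (-(n * p)) := by
    have h2 := hCε.2 n
    rw [S.ν₀_P_pow_φ₀] at h2
    have h3 := (abs_norm_sub_norm_le _ _).trans h2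
    rwa [Complex.norm_real, Real.norm_of_nonneg measureReal_nonneg, norm_pow, hln] at h3
  obtain ⟨h4, h5⟩ := abs_exp_neg_mul_ceil_sub_le hp0 ht
  calc |a - Real.exp (-t)| ≤ |a - Real.exp (-(n * p))| + |Real.exp (-(n * p)) - Real.exp (-t)| :=
        abs_sub_le _ _ _
    _ ≤ C * L.δ ε * Real.exp (-t) + (θ + 1) * ‖S.φ₀‖ * L.δ ε * Real.exp (-t) := by
        refine add_le_add (h1.trans ?_) (h5.trans ?_)
        · gcongr
        · gcongr
    _ = (C + (θ + 1) * ‖S.φ₀‖) * L.δ ε * 1 * Real.exp (-t) := by ring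
    _ ≤ _ := by
        gcongr
        exact le_max_right _ _
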